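/- Let $d\ge 0$, $n\ge 1$, let $f(\cdot,1),\dots,f(\cdot,n):\mathbb{R}^d\to\mathbb{R}$ be differentiable, $f:=\frac1n\sum_{i=1}^n f(\cdot,i)$, let $\varphi:\mathbb{R}^d\to(-\infty,\infty]$, $\mathrm{dom}(\varphi):=\{w:\varphi(w)<\infty\}$, and $\psi:=f+\varphi$. Write $\partial\psi(w)$ for the Fréchet subdifferential, i.e., the set of all $g$ with $\psi(y)\ge\psi(w)+\langle g,y-w\rangle+o(\|y-w\|)$ as $y\to w$ if $\psi(w)<\infty$, and $\partial\psi(w)=\emptyset$ otherwise; $\mathrm{dist}(0,\emptyset):=\infty$. A point $w\in\mathrm{dom}(\varphi)$ with $0\in\partial\psi(w)$ is called a stationary point of $\psi$. Assume: (F.1) there is ${\sf L}>0$ such that each $\nabla f(\cdot,i)$ is ${\sf L}$-Lipschitz continuous on $\mathrm{dom}(\varphi)$; (F.2) $\varphi$ is proper, lower semicontinuous and $\rho$-weakly convex for some $\rho>0$, i.e., $\varphi+\frac{\rho}{2}\|\cdot\|^2$ is convex; (F.3) there are $f_{\mathrm{lb}},\varphi_{\mathrm{lb}}\in\mathbb{R}$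 with $f(w,i)\ge f_{\mathrm{lb}}$ and $\varphi(w)\ge\varphi_{\mathrm{lb}}$ for all $w\in\mathrm{dom}(\varphi)$ and all $i$. Let $\lambda\in(0,\frac{1}{4\rho})$, let $\mathrm{prox}_{\lambda\varphi}(z):=\mathrm{argmin}_y\,\varphi(y)+\frac{1}{2\lambda}\|z-y\|^2$, and let $\alpha_k=\frac{\alpha}{(\beta+k)^\gamma}$ for $k\ge1$, with $\alpha>0$, $\beta\ge0$, $\gamma\in(\frac12,1]$. Let $\{z^k\}_{k\ge1}$, $\{w^k\}_{k\ge1}$ be generated by $\mathsf{norm}\text{-}\mathsf{PRR}$: $z^1\in\mathbb{R}^d$ is arbitrary, $w^1=\mathrm{prox}_{\lambda\varphi}(z^1)$, and for each $k\ge1$, with an arbitrary permutation $\pi^k$ of $\{1,\dots,n\}$ and starting from $z^k_1=z^k$, $w^k_1=w^k$, one sets $$z^k_{i+1}=z^k_i-\alpha_k\big(\nabla f(w^k_i,\pi^k_i)+\lambda^{-1}(z^k_i-w^k_i)\big),\qquad w^k_{i+1}=\mathrm{prox}_{\lambda\varphi}(z^k_{i+1}),\qquad i=1,\dots,n,$$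 and $z^{k+1}=z^k_{n+1}$, $w^{k+1}=w^k_{n+1}$. Assume further: (K.1) the sequence $\{w^k\}_k$ is bounded; (K.2) $\psi$ has the KL property at every accumulation point $\bar w$ of $\{w^k\}_k$ (at every such point in $\mathrm{dom}(\varphi)$), i.e., there are $\theta\in[0,1)$, $c>0$, $\eta\in(0,\infty]$ and a neighborhood $U$ of $\bar w$ such that $|\psi(w)-\psi(\bar w)|^\theta\le c\cdot\mathrm{dist}(0,\partial\psi(w))$ for all $w\in U$ with $0<|\psi(w)-\psi(\bar w)|<\eta$. Then $\{w^k\}_k$ has finite length, $\sum_{k=1}^\infty\|w^{k+1}-w^k\|<\infty$, and it converges to some stationary point $w^*$ of $\psi$. -/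

import Mathlib

open scoped ENNReal NNReal Topology Gradient

namespace NormPRR

/-- The effective domain `{x : h x < ∞}` of an extended-real-valued function. -/
def dom {d : ℕ} (h : EuclideanSpace ℝ (Fin d) → EReal) : Set (EuclideanSpace ℝ (Fin d)) :=
  {x | h x < ⊤}

/-- `h` takes values in `(-∞, ∞]` and is not identically `∞`. -/
def IsProper {d : ℕ} (h : EuclideanSpace ℝ (Fin d) → EReal) : Prop :=
  (∀ x, h x ≠ ⊥) ∧ (dom h).Nonempty

/-- Convexity of a function with values in `(-∞, ∞]`. -/
def IsConvex {d : ℕ} (h : EuclideanSpace ℝ (Fin d) → EReal) : Prop :=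
  ∀ x y : EuclideanSpace ℝ (Fin d), ∀ a b : ℝ, 0 < a → 0 < b → a + b = 1 →
    h (a • x + b • y) ≤ (a : EReal) * h x + (b : EReal) * h y

/-- `h` is `ρ`-weakly convex: `h + (ρ / 2) ‖·‖²` is convex. -/
def IsWeaklyConvex {d : ℕ} (ρ : ℝ) (h : EuclideanSpace ℝ (Fin d) → EReal) : Prop :=
  IsConvex (fun x => h x + ((ρ / 2 * ‖x‖ ^ 2 : ℝ) : EReal))

/-- The Fréchet (regular) subdifferential of `h` at `x`: all `g` such that
`h y ≥ h x + ⟪g, y - x⟫ + o(‖y - x‖)` as `y → x`. It is empty where `h x = ∞`. -/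
def subdiff {d : ℕ} (h : EuclideanSpace ℝ (Fin d) → EReal) (x : EuclideanSpace ℝ (Fin d)) :
    Set (EuclideanSpace ℝ (Fin d)) :=
  {g | x ∈ dom h ∧ ∀ ε : ℝ, 0 < ε → ∀ᶠ y in 𝓝 x,
    h x + ((inner ℝ g (y - x) - ε * ‖y - x‖ : ℝ) : EReal) ≤ h y}

/-- The stationary points of `h`. -/
def crit {d : ℕ} (h : EuclideanSpace ℝ (Fin d) → EReal) : Set (EuclideanSpace ℝ (Fin d)) :=
  {x | x ∈ dom h ∧ 0 ∈ subdiff h x}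

/-- The objective `ψ = f + φ` with the finite sum `f = (1 / n) ∑ i, f i`. -/
noncomputable def objective {n d : ℕ} (f : Fin n → EuclideanSpace ℝ (Fin d) → ℝ)
    (φ : EuclideanSpace ℝ (Fin d) → EReal) (x : EuclideanSpace ℝ (Fin d)) : EReal :=
  ((1 / (n : ℝ) * ∑ i, f i x : ℝ) : EReal) + φ x

/-- The proximity operator: the set of minimizers of `y ↦ φ y + ‖z - y‖² / (2 lam)`. It is a
singleton if `φ` is proper, lower semicontinuous and `ρ`-weakly convex with `lam * ρ < 1`. -/
def prox {d : ℕ} (φ : EuclideanSpace ℝ (Fin d) → EReal) (lam : ℝ)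
    (z : EuclideanSpace ℝ (Fin d)) : Set (EuclideanSpace ℝ (Fin d)) :=
  {w | ∀ y, φ w + ((1 / (2 * lam) * ‖z - w‖ ^ 2 : ℝ) : EReal) ≤
    φ y + ((1 / (2 * lam) * ‖z - y‖ ^ 2 : ℝ) : EReal)}

/-- `z¹, z², …` and `w¹, w², …` are generated by normal map-based proximal random reshuffling
with proximal parameter `lam`, step sizes `α 1, α 2, …` and permutations `π 1, π 2, …`
(the values at index `0` play no role). In epoch `k`, the inner iterates are `zi`, `wi`. -/
structure IsNormPRR {n d : ℕ} (f : Fin n → EuclideanSpace ℝ (Fin d) → ℝ)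
    (φ : EuclideanSpace ℝ (Fin d) → EReal) (lam : ℝ) (α : ℕ → ℝ)
    (π : ℕ → Equiv.Perm (Fin n)) (z w : ℕ → EuclideanSpace ℝ (Fin d)) : Prop where
  init : w 1 ∈ prox φ lam (z 1)
  epoch : ∀ k : ℕ, 1 ≤ k → ∃ zi wi : Fin (n + 1) → EuclideanSpace ℝ (Fin d),
    zi 0 = z k ∧ wi 0 = w k ∧
    (∀ i : Fin n,
      zi i.succ = zi i.castSucc -
        α k • (∇ (f (π k i)) (wi i.castSucc) + lam⁻¹ • (zi i.castSucc - wi i.castSucc)) ∧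
      wi i.succ ∈ prox φ lam (zi i.succ)) ∧
    z (k + 1) = zi (Fin.last n) ∧ w (k + 1) = wi (Fin.last n)

/-- The set of accumulation points of the sequence `w 1, w 2, …`. -/
def accPts {d : ℕ} (w : ℕ → EuclideanSpace ℝ (Fin d)) : Set (EuclideanSpace ℝ (Fin d)) :=
  {x | ∃ l : ℕ → ℕ, StrictMono l ∧ Filter.Tendsto (fun k => w (l k)) Filter.atTop (𝓝 x)}

/-- The Kurdyka-Łojasiewicz property of `h` at a point `x` of its domain, with some exponent
`θ ∈ [0, 1)`. The distance of `0` to an empty subdifferential is `∞`; the condition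
`|h y - h x| < η` forces `h y` to be finite, also for `η = ∞`. -/
def HasKL {d : ℕ} (h : EuclideanSpace ℝ (Fin d) → EReal) (x : EuclideanSpace ℝ (Fin d)) : Prop :=
  ∃ θ c : ℝ, ∃ η : ℝ≥0∞, ∃ U ∈ 𝓝 x, 0 ≤ θ ∧ θ < 1 ∧ 0 < c ∧ 0 < η ∧
    ∀ y ∈ U, 0 < (h y - h x).abs → (h y - h x).abs < η →
      (h y - h x).abs ^ θ ≤ ENNReal.ofReal c * Metric.infEDist 0 (subdiff h y)

end NormPRR

namespace NormPRR

open Filter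

/-! ### Real sequences -/

/-! Let F = ∇f(w) + λ⁻¹(z - w), with w = prox(z), be the normal map. It is a Fréchet subgradient of
ψ at w, so the KL inequality bounds ‖F‖ from below. As the w-iterates are bounded, a late epoch is a
step z - a(F + e) with a = nα_k and ‖e‖ ≤ C a (‖F‖ + 1), whatever the permutation
(`exists_error_of_epoch`).

The descent of ψ(w) is governed by ‖w' - w‖²/a, which need not control ‖F‖. The merit function H =
ψ(w) + (τλ/2)‖F‖² repairs this: for small a it falls by (τ/4)a‖F‖² up to O(a³) (`merit_le`). Since ∑
a³ < ∞ and ∑ a = ∞, F tends to 0 and ψ(w) to some l (`tendsto_of_descent`); accumulation points are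
stationary with value l (`mem_crit_of_tendsto`).

Adding to H - l an explicit v of order k^(-(3γ-1)) absorbs the cubic errors and gives an antitone E
→ 0. Near an accumulation point KL becomes E^θ ≤ B'‖F‖ + v^θ, and concavity of t^(1-θ) bounds a‖F‖
by decrements of E^(1-θ) plus a multiple of a v^θ (`mul_le_of_rpow_le`). The latter is summable once
θ > (1-γ)/(3γ-1). This threshold is below 1 exactly because γ > 1/2, and KL exponents may be raised.
The prox is Lipschitz, so steps of w are O(a‖F‖ + a²), hence summable while w stays near that point;
`summable_norm_sub_of_local` removes the proviso. -/

/-- A sequence that is bounded below and increases by summable amounts converges. -/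
lemma exists_tendsto_of_le_add_summable {x s : ℕ → ℝ} (hs : Summable s) {m : ℝ}
    (hm : ∀ k, m ≤ x k) (h : ∀ k, x (k + 1) ≤ x k + s k) : ∃ l, Tendsto x atTop (𝓝 l) := by
  set S : ℕ → ℝ := fun k => ∑ i ∈ Finset.range k, s i with hS
  have hSt : Tendsto S atTop (𝓝 (∑' i, s i)) := hs.hasSum.tendsto_sum_nat
  obtain ⟨B, hB⟩ := hSt.bddAbove_range
  have hanti : Antitone fun k => x k - S k := by
    refine antitone_nat_of_succ_le fun k => ?_
    simp only [hS, Finset.sum_range_succ]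
    linarith [h k]
  have hbdd : BddBelow (Set.range fun k => x k - S k) := by
    refine ⟨m - B, ?_⟩
    rintro _ ⟨k, rfl⟩
    have := hB ⟨k, rfl⟩
    have := hm k
    simp only
    linarith
  refine ⟨_, ((tendsto_atTop_ciInf hanti hbdd).add hSt).congr fun k => ?_⟩
  simp

/-- If `H` decreases by `c a y ^ 2` up to errors of order `a ^ 3` with `∑ a = ∞`, and `y ^ 2`
changes slowly, then `y` tends to zero and `H` converges. -/
lemma tendsto_of_descent {H y a : ℕ → ℝ} {c C D m : ℝ} (hc : 0 < c)
    (hC : 0 ≤ C) (ha : ∀ k, 0 < a k) (hns : ¬ Summable a) (hcub : Summable fun k => a k ^ 3)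
    (hy : ∀ k, 0 ≤ y k) (hm : ∀ k, m ≤ H k)
    (hH : ∀ k, H (k + 1) ≤ H k - c * (a k * y k ^ 2) + C * a k ^ 3)
    (hyD : ∀ k, y (k + 1) ^ 2 ≤ y k ^ 2 + D * (a k * y k ^ 2 + a k ^ 3)) :
    Tendsto y atTop (𝓝 0) ∧ ∃ l, Tendsto H atTop (𝓝 l) := by
  have hay : ∀ k, 0 ≤ a k * y k ^ 2 := fun k => mul_nonneg (ha k).le (sq_nonneg _)
  have ha3 : ∀ k, 0 ≤ a k ^ 3 := fun k => pow_nonneg (ha k).le 3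
  have hsum : Summable fun k => a k * y k ^ 2 := by
    have key : ∀ n, c * ∑ k ∈ Finset.range n, a k * y k ^ 2 ≤
        H 0 - H n + C * ∑ k ∈ Finset.range n, a k ^ 3 := by
      intro n
      induction n with
      | zero => simp
      | succ n ih =>
        rw [Finset.sum_range_succ, Finset.sum_range_succ]
        linarith [hH n]
    refine summable_of_sum_range_le (c := (H 0 - m + C * ∑' k, a k ^ 3) / c) hay fun n => ?_
    rw [le_div_iff₀ hc, mul_comm]
    have h1 := hcub.sum_le_tsum (Finset.range n) fun k _ => ha3 k
    have h2 := mul_le_mul_of_nonneg_left h1 hC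
    linarith [key n, hm n]
  refine ⟨?_, exists_tendsto_of_le_add_summable (hcub.mul_left C) hm fun k => ?_⟩
  -- Summability of `a * y ^ 2` alone only makes `y` small along a subsequence; `hyD` makes all of
  -- `y ^ 2` converge.
  · obtain ⟨l, hl⟩ := exists_tendsto_of_le_add_summable ((hsum.add hcub).mul_left D)
      (fun k => sq_nonneg (y k)) hyD
    have hl0 : 0 ≤ l := ge_of_tendsto' hl fun k => sq_nonneg _
    have hl' : l = 0 := by
      -- A positive limit would bound `a` by a multiple of the summable `a * y ^ 2`.
      by_contra hne
      have hlpos : 0 < l := lt_of_le_of_ne hl0 (Ne.symm hne)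
      apply hns
      have hev : ∀ᶠ k in atTop, l / 2 < y k ^ 2 := hl.eventually (lt_mem_nhds (by linarith))
      refine Summable.of_norm_bounded_eventually_nat (hsum.mul_left (2 / l)) ?_
      filter_upwards [hev] with k hk
      rw [Real.norm_of_nonneg (ha k).le]
      have : a k * (l / 2) ≤ a k * y k ^ 2 := mul_le_mul_of_nonneg_left hk.le (ha k).le
      calc a k = 2 / l * (a k * (l / 2)) := by field_simp
        _ ≤ _ := by gcongr
    rw [hl'] at hl
    have := hl.sqrt
    simpa [Real.sqrt_sq (hy _)] using this
  · linarith [hH k, mul_nonneg hc.le (hay k)]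

/-- The increment estimate obtained from the desingularizing function `t ↦ t ^ (1 - θ)`. -/
lemma mul_le_of_rpow_le {E E' a y B v θ c : ℝ} (hE : 0 ≤ E) (hE' : 0 ≤ E') (ha : 0 < a)
    (hy : 0 ≤ y) (hB : 0 < B) (hv : 0 ≤ v) (hc : 0 < c) (hθ0 : 0 ≤ θ) (hθ1 : θ < 1)
    (hdec : E' ≤ E - c * (a * y ^ 2)) (hKL : E ^ θ ≤ B * y + v) :
    a * y ≤ 2 * B / ((1 - θ) * c) * (E ^ (1 - θ) - E' ^ (1 - θ)) + a * v / B := by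
  have hθ : 0 < 1 - θ := by linarith
  have hay : 0 ≤ c * (a * y ^ 2) := by positivity
  have hmono : E' ^ (1 - θ) ≤ E ^ (1 - θ) :=
    Real.rpow_le_rpow hE' (by linarith) hθ.le
  have hK : 0 ≤ 2 * B / ((1 - θ) * c) * (E ^ (1 - θ) - E' ^ (1 - θ)) :=
    mul_nonneg (by positivity) (by linarith)
  have hav : 0 ≤ a * v / B := by positivity
  rcases hy.eq_or_lt with rfl | hy'
  · simp only [mul_zero]; linarith
  -- Either the error `v` dominates and the last term suffices, or `E ^ θ ≤ 2 * B * y`.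
  rcases le_total (B * y) v with h | h
  · have : a * y ≤ a * v / B := by
      rw [le_div_iff₀ hB]; nlinarith
    linarith
  have hEpos : 0 < E := by
    have : 0 < c * (a * y ^ 2) := by positivity
    linarith
  -- Bernoulli at `E' / E` is the tangent-line bound for the concave power `1 - θ`.
  have hbern := rpow_one_add_le_one_add_mul_self (s := E' / E - 1)
    (by have : 0 ≤ E' / E := by positivity
        linarith) hθ.le (by linarith)
  have hEp : 0 < E ^ (1 - θ) := Real.rpow_pos_of_pos hEpos _
  have hEθ : 0 < E ^ θ := Real.rpow_pos_of_pos hEpos _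
  have hEE : E = E ^ θ * E ^ (1 - θ) := by rw [← Real.rpow_add hEpos]; simp
  rw [add_sub_cancel, Real.div_rpow hE' hE, div_le_iff₀ hEp] at hbern
  have h1 : (1 - θ) * (E - E') ≤ E ^ θ * (E ^ (1 - θ) - E' ^ (1 - θ)) := by
    have h2 : (1 - θ) * (E - E') = E ^ θ * (-((1 - θ) * (E' / E - 1) * E ^ (1 - θ))) := by
      have : E ^ θ * (-((1 - θ) * (E' / E - 1) * E ^ (1 - θ))) =
          -((1 - θ) * (E' / E - 1)) * (E ^ θ * E ^ (1 - θ)) := by ring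
      rw [this, ← hEE]
      field_simp
      ring
    rw [h2]
    refine mul_le_mul_of_nonneg_left ?_ hEθ.le
    linarith
  set Δ := E ^ (1 - θ) - E' ^ (1 - θ) with hΔ
  have hΔ0 : 0 ≤ Δ := by linarith
  have h3 : (1 - θ) * (c * (a * y ^ 2)) ≤ 2 * B * y * Δ := by
    calc (1 - θ) * (c * (a * y ^ 2)) ≤ (1 - θ) * (E - E') :=
          mul_le_mul_of_nonneg_left (by linarith) hθ.le
      _ ≤ E ^ θ * Δ := h1
      _ ≤ 2 * B * y * Δ := mul_le_mul_of_nonneg_right (by linarith) hΔ0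
  have h4 : a * y ≤ 2 * B / ((1 - θ) * c) * Δ := by
    rw [div_mul_eq_mul_div, le_div_iff₀ (by positivity)]
    refine le_of_mul_le_mul_right ?_ hy'
    calc a * y * ((1 - θ) * c) * y = (1 - θ) * (c * (a * y ^ 2)) := by ring
      _ ≤ _ := by linarith
  linarith

/-- The decrements of a nonnegative antitone sequence are summable. -/
lemma summable_sub_of_antitone {x : ℕ → ℝ} (hx : ∀ k, 0 ≤ x k) (hanti : Antitone x) :
    Summable fun k => x k - x (k + 1) := by
  refine summable_of_sum_range_le (c := x 0) (fun k => sub_nonneg.2 (hanti k.le_succ)) fun n => ?_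
  rw [Finset.sum_range_sub']
  linarith [hx n]

/-- If the steps of `w` are dominated by a summable sequence as long as `w` stays close to one of
its accumulation points, then `w` has finite length. -/
lemma summable_norm_sub_of_local {E : Type*} [NormedAddCommGroup E] {w : ℕ → E} {x : E}
    {b : ℕ → ℝ} {r : ℝ} (hr : 0 < r) (hb : Summable b) (hb0 : ∀ k, 0 ≤ b k)
    (hx : MapClusterPt x atTop w)
    (h : ∀ᶠ k in atTop, ‖w k - x‖ < r → ‖w (k + 1) - w k‖ ≤ b k) :
    Summable fun k => ‖w (k + 1) - w k‖ := by
  obtain ⟨N₀, hN₀⟩ := eventually_atTop.1 h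
  have htail := tendsto_sum_nat_add b
  have hev : ∀ᶠ N in atTop, ∑' k, b (k + N) < r / 2 :=
    htail.eventually (gt_mem_nhds (by linarith))
  have hfreq : ∃ᶠ N in atTop, ‖w N - x‖ < r / 2 := by
    have := hx.frequently (Metric.ball_mem_nhds x (half_pos hr))
    simpa [Metric.mem_ball, dist_eq_norm] using this
  -- Starting in the half ball with remaining budget below `r / 2`, the sequence never leaves the
  -- ball, so `h` stays applicable.
  obtain ⟨N, hNx, hNb, hNN⟩ := (hfreq.and_eventually (hev.and (eventually_ge_atTop N₀))).exists
  have hbN : Summable fun k => b (k + N) := (summable_nat_add_iff N).2 hb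
  have key : ∀ j, ‖w (j + N) - x‖ ≤ ‖w N - x‖ + ∑ i ∈ Finset.range j, b (i + N) := by
    intro j
    induction j with
    | zero => simp
    | succ j ih =>
      have h1 := hbN.sum_le_tsum (Finset.range j) fun k _ => hb0 _
      have h2 := hN₀ (j + N) (by omega) (by linarith)
      rw [Finset.sum_range_succ, show j + 1 + N = j + N + 1 by omega]
      calc ‖w (j + N + 1) - x‖ = ‖(w (j + N + 1) - w (j + N)) + (w (j + N) - x)‖ := by
            congr 1; abel
        _ ≤ _ := norm_add_le _ _
        _ ≤ _ := by linarith
  rw [← summable_nat_add_iff N]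
  refine hbN.of_nonneg_of_le (fun _ => norm_nonneg _) fun j => hN₀ (j + N) (by omega) ?_
  have h1 := hbN.sum_le_tsum (Finset.range j) fun k _ => hb0 _
  linarith [key j]

/-! ### Polynomial step sizes -/

/-- Used with `q = 3γ - 1` to write the cubic step errors as decrements of an explicit null
sequence. The bounds log s ≤ s - 1 and 1 + u ≤ exp u give the decrement in terms of `t + 1`; the
power of 2 pays for t + 1 ≤ 2t. -/
lemma rpow_neg_sub_rpow_neg_le {q t : ℝ} (hq : 0 < q) (ht : 1 ≤ t) :
    q * 2 ^ (-(q + 1)) * t ^ (-(q + 1)) ≤ t ^ (-q) - (t + 1) ^ (-q) := by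
  have ht0 : 0 < t := by linarith
  have ht1 : 0 < t + 1 := by linarith
  have h1 : (t + 1) ^ (-q) * (1 + q * (1 / (t + 1))) ≤ t ^ (-q) := by
    have hlog : Real.log (t / (t + 1)) ≤ t / (t + 1) - 1 :=
      Real.log_le_sub_one_of_pos (by positivity)
    have hs : t / (t + 1) - 1 = -(1 / (t + 1)) := by field_simp; ring
    have h2 : 1 + q * (1 / (t + 1)) ≤ (t / (t + 1)) ^ (-q) := by
      rw [Real.rpow_def_of_pos (by positivity)]
      have := Real.add_one_le_exp (Real.log (t / (t + 1)) * -q)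
      nlinarith
    calc _ ≤ (t + 1) ^ (-q) * (t / (t + 1)) ^ (-q) := by gcongr
      _ = t ^ (-q) := by
        rw [← Real.mul_rpow ht1.le (by positivity)]
        congr 1
        field_simp
  have h3 : (2 : ℝ) ^ (-(q + 1)) * t ^ (-(q + 1)) ≤ (t + 1) ^ (-(q + 1)) := by
    rw [← Real.mul_rpow (by norm_num) ht0.le]
    exact Real.rpow_le_rpow_of_nonpos ht1 (by linarith) (by linarith)
  have h4 : (t + 1) ^ (-(q + 1)) = (t + 1) ^ (-q) * (1 / (t + 1)) := by
    rw [neg_add, Real.rpow_add ht1, Real.rpow_neg_one, one_div]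
  calc _ = q * ((2 : ℝ) ^ (-(q + 1)) * t ^ (-(q + 1))) := by ring
    _ ≤ q * (t + 1) ^ (-(q + 1)) := by gcongr
    _ ≤ _ := by rw [h4]; linarith

lemma summable_rpow_neg_iff {b : ℝ} (hb : 0 < b) (p : ℝ) :
    Summable (fun k : ℕ => (b + k) ^ (-p)) ↔ 1 < p := by
  rw [← Real.summable_one_div_nat_add_rpow b p]
  refine summable_congr fun k => ?_
  have : 0 < (k : ℝ) + b := by positivity
  rw [abs_of_pos this, Real.rpow_neg (by positivity), one_div, add_comm]

end NormPRR

namespace NormPRR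

open Filter

variable {d : ℕ} {φ : EuclideanSpace ℝ (Fin d) → EReal} {ρ lam : ℝ}
  {x y z w z' w' g : EuclideanSpace ℝ (Fin d)}

/-! ### Weakly convex functions and their proximity operators -/

lemma IsProper.coe_toReal (h : IsProper φ) (hx : x ∈ dom φ) : ((φ x).toReal : EReal) = φ x :=
  EReal.coe_toReal (ne_of_lt hx) (h.1 x)

lemma mem_dom_of_le_coe {r : ℝ} (h : φ x ≤ (r : EReal)) : x ∈ dom φ :=
  lt_of_le_of_lt h (EReal.coe_lt_top r)

lemma IsProper.toReal_le (h : IsProper φ) {r : ℝ} (hx : φ x ≤ (r : EReal)) :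
    (φ x).toReal ≤ r := by
  rw [← h.coe_toReal (mem_dom_of_le_coe hx)] at hx
  exact_mod_cast hx

/-- The identity `hsq` converts the quadratic term into a defect. The real right-hand side also puts
the convex combination in the domain. -/
lemma IsWeaklyConvex.le_coe (h : IsWeaklyConvex ρ φ) (hp : IsProper φ) (hx : x ∈ dom φ)
    (hy : y ∈ dom φ) {a b : ℝ} (ha : 0 < a) (hb : 0 < b) (hab : a + b = 1) :
    φ (a • x + b • y) ≤ ((a * (φ x).toReal + b * (φ y).toReal +
      ρ / 2 * (a * b) * ‖x - y‖ ^ 2 : ℝ) : EReal) := by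
  have key := h x y a b ha hb hab
  simp only at key
  rw [← hp.coe_toReal hx, ← hp.coe_toReal hy] at key
  have hsq : a * ‖x‖ ^ 2 + b * ‖y‖ ^ 2 - ‖a • x + b • y‖ ^ 2 = a * b * ‖x - y‖ ^ 2 := by
    rw [@norm_add_sq_real, @norm_sub_sq_real, norm_smul, norm_smul, inner_smul_left,
      inner_smul_right, Real.norm_of_nonneg ha.le, Real.norm_of_nonneg hb.le]
    simp only [conj_trivial]
    obtain rfl : b = 1 - a := by linarith
    ring
  have key' : φ (a • x + b • y) + ((ρ / 2 * ‖a • x + b • y‖ ^ 2 : ℝ) : EReal) ≤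
      ((a * ((φ x).toReal + ρ / 2 * ‖x‖ ^ 2) + b * ((φ y).toReal + ρ / 2 * ‖y‖ ^ 2) : ℝ) :
        EReal) := by
    push_cast at key ⊢
    exact key
  generalize hv : φ (a • x + b • y) = v at key' ⊢
  induction v with
  | bot => exact bot_le
  | top =>
    rw [EReal.top_add_coe] at key'
    exact absurd key' (not_le.2 (EReal.coe_lt_top _))
  | coe v =>
    norm_cast at key' ⊢
    linear_combination key' + ρ / 2 * hsq

lemma IsWeaklyConvex.convex_dom (h : IsWeaklyConvex ρ φ) (hp : IsProper φ) :
    Convex ℝ (dom φ) := by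
  rw [convex_iff_forall_pos]
  intro x hx y hy a b ha hb hab
  exact mem_dom_of_le_coe (h.le_coe hp hx hy ha hb hab)

lemma mem_dom_of_mem_prox (hp : IsProper φ) (hw : w ∈ prox φ lam z) : w ∈ dom φ := by
  obtain ⟨y, hy⟩ := hp.2
  have h := hw y
  rw [← hp.coe_toReal hy, ← EReal.coe_add] at h
  by_contra hne
  have : φ w = ⊤ := by simpa [dom] using hne
  rw [this, EReal.top_add_coe] at h
  exact absurd h (not_le.2 (EReal.coe_lt_top _))

/-- The proximal inequality: `lam⁻¹ • (z - prox z)` is a proximal subgradient. -/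
lemma le_toReal_of_mem_prox (hp : IsProper φ) (hφ : IsWeaklyConvex ρ φ) (hlam : 0 < lam)
    (hw : w ∈ prox φ lam z) (hy : y ∈ dom φ) :
    (φ w).toReal + inner ℝ (lam⁻¹ • (z - w)) (y - w) - ρ / 2 * ‖y - w‖ ^ 2 ≤
      (φ y).toReal := by
  have hwd := mem_dom_of_mem_prox hp hw
  -- Compare the minimizer `w` with the point a fraction `t` of the way to `y` and divide by `t`;
  -- the limit t → 0 then removes the quadratic prox term.
  have key : ∀ t ∈ Set.Ioo (0 : ℝ) 1, (φ w).toReal + inner ℝ (lam⁻¹ • (z - w)) (y - w)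
      - ρ / 2 * (1 - t) * ‖y - w‖ ^ 2 - t * (1 / (2 * lam) * ‖y - w‖ ^ 2) ≤ (φ y).toReal := by
    intro t ht
    have h1 := hφ.le_coe hp hwd hy (sub_pos.2 ht.2) ht.1 (by ring)
    have hd := mem_dom_of_le_coe h1
    have h2 := hp.toReal_le h1
    have h3 := hw ((1 - t) • w + t • y)
    rw [← hp.coe_toReal hwd, ← hp.coe_toReal hd] at h3
    norm_cast at h3
    have h4 : ‖z - ((1 - t) • w + t • y)‖ ^ 2 =
        ‖z - w‖ ^ 2 - 2 * t * inner ℝ (z - w) (y - w) + t ^ 2 * ‖y - w‖ ^ 2 := by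
      have : z - ((1 - t) • w + t • y) = (z - w) - t • (y - w) := by module
      rw [this, @norm_sub_sq_real, inner_smul_right, norm_smul, Real.norm_of_nonneg ht.1.le]
      ring
    rw [h4] at h3
    rw [norm_sub_rev w y] at h2
    rw [inner_smul_left, conj_trivial]
    have h5 : 1 / (2 * lam) * (‖z - w‖ ^ 2 - 2 * t * inner ℝ (z - w) (y - w) +
        t ^ 2 * ‖y - w‖ ^ 2) = 1 / (2 * lam) * ‖z - w‖ ^ 2
          - t * (lam⁻¹ * inner ℝ (z - w) (y - w)) + t * (t * (1 / (2 * lam) * ‖y - w‖ ^ 2)) := by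
      field_simp
    rw [h5] at h3
    refine le_of_mul_le_mul_left ?_ ht.1
    nlinarith
  have hlim : Tendsto (fun t : ℝ => (φ w).toReal + inner ℝ (lam⁻¹ • (z - w)) (y - w)
      - ρ / 2 * (1 - t) * ‖y - w‖ ^ 2 - t * (1 / (2 * lam) * ‖y - w‖ ^ 2)) (𝓝[>] 0)
      (𝓝 ((φ w).toReal + inner ℝ (lam⁻¹ • (z - w)) (y - w)
      - ρ / 2 * (1 - 0) * ‖y - w‖ ^ 2 - 0 * (1 / (2 * lam) * ‖y - w‖ ^ 2))) :=
    (Continuous.tendsto (by fun_prop) 0).mono_left nhdsWithin_le_nhds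
  have := le_of_tendsto hlim
    (by filter_upwards [Ioo_mem_nhdsGT one_pos] with t ht using key t ht)
  simpa using this

/-- Sum of the proximal inequalities at the two points, each tested at the other. -/
lemma inner_ge_of_mem_prox (hp : IsProper φ) (hφ : IsWeaklyConvex ρ φ) (hlam : 0 < lam)
    (hw : w ∈ prox φ lam z) (hw' : w' ∈ prox φ lam z') :
    (1 - lam * ρ) * ‖w' - w‖ ^ 2 ≤ inner ℝ (z' - z) (w' - w) := by
  have h1 := le_toReal_of_mem_prox hp hφ hlam hw (mem_dom_of_mem_prox hp hw')
  have h2 := le_toReal_of_mem_prox hp hφ hlam hw' (mem_dom_of_mem_prox hp hw)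
  rw [norm_sub_rev w w', ← neg_sub w' w, inner_neg_right] at h2
  rw [inner_smul_left, conj_trivial] at h1 h2
  have h3 : lam⁻¹ * inner ℝ (z - w) (w' - w) - lam⁻¹ * inner ℝ (z' - w') (w' - w) ≤
      ρ * ‖w' - w‖ ^ 2 := by linarith
  rw [← mul_sub, ← inner_sub_left, inv_mul_le_iff₀ hlam,
    show z - w - (z' - w') = (w' - w) - (z' - z) by abel, inner_sub_left,
    real_inner_self_eq_norm_sq] at h3
  linarith

/-- Cauchy-Schwarz in the monotonicity estimate gives the constant 4/3, rounded up to 2. -/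
lemma norm_sub_le_of_mem_prox (hp : IsProper φ) (hφ : IsWeaklyConvex ρ φ) (hlam : 0 < lam)
    (hρ : lam * ρ ≤ 1 / 4)
    (hw : w ∈ prox φ lam z) (hw' : w' ∈ prox φ lam z') :
    ‖w' - w‖ ≤ 2 * ‖z' - z‖ := by
  have h := inner_ge_of_mem_prox hp hφ hlam hw hw'
  have h2 := real_inner_le_norm (z' - z) (w' - w)
  rcases (norm_nonneg (w' - w)).eq_or_lt with h0 | h0
  · rw [← h0]; positivity
  · refine le_of_mul_le_mul_right ?_ h0
    nlinarith

/-! ### Smooth functions and the subdifferential of the objective -/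

/-- The descent lemma on a convex set. -/
lemma le_add_of_lipschitzOnWith_gradient {h : EuclideanSpace ℝ (Fin d) → ℝ}
    (hh : Differentiable ℝ h) {s : Set (EuclideanSpace ℝ (Fin d))} (hs : Convex ℝ s) {L : ℝ≥0}
    (hL : LipschitzOnWith L (∇ h) s) (hx : x ∈ s) (hy : y ∈ s) :
    h y ≤ h x + inner ℝ (∇ h x) (y - x) + L / 2 * ‖y - x‖ ^ 2 := by
  have hder : ∀ t : ℝ, HasDerivAt (fun t : ℝ => h (x + t • (y - x)))
      (inner ℝ (∇ h (x + t • (y - x))) (y - x)) t := by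
    intro t
    have h1 := (hh (x + t • (y - x))).hasGradientAt.hasFDerivAt
    have h2 : HasDerivAt (fun t : ℝ => x + t • (y - x)) (y - x) t := by
      simpa using ((hasDerivAt_id t).smul_const (y - x)).const_add x
    have := h1.comp_hasDerivAt t h2
    simpa using! this
  have hB : ∀ t : ℝ, HasDerivAt
      (fun t : ℝ => h x + t * inner ℝ (∇ h x) (y - x) + L / 2 * ‖y - x‖ ^ 2 * t ^ 2)
      (inner ℝ (∇ h x) (y - x) + L * ‖y - x‖ ^ 2 * t) t := by
    intro t
    have := (((hasDerivAt_id t).mul_const (inner ℝ (∇ h x) (y - x))).const_add (h x)).add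
      ((hasDerivAt_pow 2 t).const_mul (L / 2 * ‖y - x‖ ^ 2))
    refine this.congr_deriv ?_
    simp
    ring
  have := image_le_of_deriv_right_le_deriv_boundary (a := 0) (b := 1)
    (fun t _ => (hder t).continuousAt.continuousWithinAt) (fun t _ => (hder t).hasDerivWithinAt)
    (by simp) (fun t _ => (hB t).continuousAt.continuousWithinAt)
    (fun t _ => (hB t).hasDerivWithinAt) (fun t ht => ?_) (Set.right_mem_Icc.2 zero_le_one)
  · simpa using this
  · have hmem : x + t • (y - x) ∈ s := hs.add_smul_sub_mem hx hy ⟨ht.1, ht.2.le⟩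
    have h1 : ‖∇ h (x + t • (y - x)) - ∇ h x‖ ≤ L * ‖x + t • (y - x) - x‖ := by
      simpa [dist_eq_norm] using hL.dist_le_mul _ hmem _ hx
    rw [add_sub_cancel_left, norm_smul, Real.norm_of_nonneg ht.1] at h1
    have h2 := real_inner_le_norm (∇ h (x + t • (y - x)) - ∇ h x) (y - x)
    rw [inner_sub_left] at h2
    nlinarith [mul_le_mul_of_nonneg_right h1 (norm_nonneg (y - x))]

/-- The sum of a gradient and a proximal subgradient is a Fréchet subgradient. -/
lemma add_mem_subdiff {h : EuclideanSpace ℝ (Fin d) → ℝ} {v : EuclideanSpace ℝ (Fin d)}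
    (hh : HasGradientAt h v x) (hp : IsProper φ) (hx : x ∈ dom φ)
    (hg : ∀ y ∈ dom φ, (φ x).toReal + inner ℝ g (y - x) - ρ / 2 * ‖y - x‖ ^ 2 ≤
      (φ y).toReal) :
    v + g ∈ subdiff (fun y => (h y : EReal) + φ y) x := by
  refine ⟨?_, fun ε hε => ?_⟩
  · change (h x : EReal) + φ x < ⊤
    rw [← hp.coe_toReal hx]
    exact_mod_cast EReal.coe_lt_top _
  have h1 : ∀ᶠ y in 𝓝 x, ‖h y - h x - inner ℝ v (y - x)‖ ≤ ε / 2 * ‖y - x‖ := by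
    have := (hasGradientAt_iff_isLittleO.1 hh).def (half_pos hε)
    simpa using this
  have h2 : ∀ᶠ y in 𝓝 x, ρ / 2 * ‖y - x‖ < ε / 2 := by
    have : Tendsto (fun y => ρ / 2 * ‖y - x‖) (𝓝 x) (𝓝 (ρ / 2 * ‖x - x‖)) :=
      Continuous.tendsto (by fun_prop) x
    exact this.eventually (gt_mem_nhds (by simpa using half_pos hε))
  filter_upwards [h1, h2] with y hy1 hy2
  by_cases hyd : y ∈ dom φ
  · rw [← hp.coe_toReal hyd, ← hp.coe_toReal hx]
    norm_cast
    have h3 := (abs_le.1 hy1).1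
    have h4 := mul_le_mul_of_nonneg_right hy2.le (norm_nonneg (y - x))
    rw [inner_add_left]
    nlinarith [hg y hyd]
  · have : φ y = ⊤ := by simpa [dom] using hyd
    rw [this, EReal.coe_add_top]
    exact le_top

/-- A real-valued form of the KL property, in which the exponent may be increased. -/
lemma HasKL.exists_rpow_le {ψ : EuclideanSpace ℝ (Fin d) → EReal} {p θ₁ : ℝ} (h : HasKL ψ x)
    (hp : ψ x = p) (h₁ : θ₁ < 1) :
    ∃ θ C r δ : ℝ, 1 / 2 ≤ θ ∧ θ₁ ≤ θ ∧ θ < 1 ∧ 0 < C ∧ 0 < r ∧ 0 < δ ∧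
      ∀ y, ‖y - x‖ < r → ∀ s : ℝ, ψ y = s → |s - p| < δ → ∀ g ∈ subdiff ψ y,
        |s - p| ^ θ ≤ C * ‖g‖ := by
  obtain ⟨θ, c, η, U, hU, hθ0, hθ1, hc, hη, hKL⟩ := h
  obtain ⟨r, hr, hrU⟩ := Metric.mem_nhds_iff.1 hU
  obtain ⟨δ, hδ0, hδη⟩ : ∃ δ : ℝ, 0 < δ ∧ ENNReal.ofReal δ ≤ η := by
    by_cases hη' : η = ⊤
    · exact ⟨1, one_pos, by simp [hη']⟩
    · exact ⟨η.toReal, ENNReal.toReal_pos hη.ne' hη', by rw [ENNReal.ofReal_toReal hη']⟩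
  -- Capping |s - p| by 1 lets the exponent grow. The floor 1/2 handles the ‖F‖² term of the merit
  -- function, `θ₁` the summability of the errors.
  refine ⟨max θ (max (1 / 2) θ₁), c, r, min δ 1, by simp, by simp,
    by norm_num [hθ1, h₁], hc, hr, by positivity, fun y hy s hs hsp g hg => ?_⟩
  rcases (abs_nonneg (s - p)).eq_or_lt with h0 | h0
  · rw [← h0, Real.zero_rpow]
    · positivity
    · have : (1 : ℝ) / 2 ≤ max θ (max (1 / 2) θ₁) := by simp
      linarith
  have habs : (ψ y - ψ x).abs = ENNReal.ofReal |s - p| := by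
    rw [hs, hp, ← EReal.coe_sub, EReal.abs_def]
  have := hKL y (hrU (by simpa [dist_eq_norm] using hy)) (by rw [habs]; simpa using h0)
    (by rw [habs]
        refine lt_of_lt_of_le ?_ hδη
        exact (ENNReal.ofReal_lt_ofReal_iff hδ0).2 (lt_of_lt_of_le hsp (min_le_left _ _)))
  rw [habs, ENNReal.ofReal_rpow_of_nonneg h0.le hθ0] at this
  have h2 : Metric.infEDist 0 (subdiff ψ y) ≤ ENNReal.ofReal ‖g‖ := by
    refine (Metric.infEDist_le_edist_of_mem hg).trans ?_
    rw [edist_dist, dist_zero_left]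
  have h3 := this.trans (mul_le_mul_right h2 _)
  rw [← ENNReal.ofReal_mul hc.le, ENNReal.ofReal_le_ofReal_iff (by positivity)] at h3
  refine le_trans ?_ h3
  exact Real.rpow_le_rpow_of_exponent_ge h0 (hsp.le.trans (min_le_right _ _)) (le_max_left _ _)

end NormPRR

namespace NormPRR

open Filter

variable {n d : ℕ} {φ : EuclideanSpace ℝ (Fin d) → EReal} {ρ lam : ℝ}
  {x z w : EuclideanSpace ℝ (Fin d)}

/-! ### One epoch as an inexact step along the normal map -/

/-- The smooth part of the objective. -/
noncomputable def smoothPart (f : Fin n → EuclideanSpace ℝ (Fin d) → ℝ)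
    (x : EuclideanSpace ℝ (Fin d)) : ℝ :=
  1 / (n : ℝ) * ∑ i, f i x

/-- The normal map of `h + φ` at `z`, where `w` is the proximal point of `z`. -/
noncomputable def normalMap (h : EuclideanSpace ℝ (Fin d) → ℝ) (lam : ℝ)
    (z w : EuclideanSpace ℝ (Fin d)) : EuclideanSpace ℝ (Fin d) :=
  ∇ h w + lam⁻¹ • (z - w)

lemma hasGradientAt_smoothPart {f : Fin n → EuclideanSpace ℝ (Fin d) → ℝ}
    (hf : ∀ i, Differentiable ℝ (f i)) (x : EuclideanSpace ℝ (Fin d)) :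
    HasGradientAt (smoothPart f) ((1 / (n : ℝ)) • ∑ i, ∇ (f i) x) x := by
  rw [hasGradientAt_iff_hasFDerivAt]
  have h := (HasFDerivAt.fun_sum (u := Finset.univ)
    fun i _ => (hf i x).hasGradientAt.hasFDerivAt).const_mul (1 / (n : ℝ))
  refine h.congr_fderiv ?_
  simp [map_sum]

lemma lipschitzOnWith_gradient_smoothPart {f : Fin n → EuclideanSpace ℝ (Fin d) → ℝ}
    (hn : 0 < n) (hf : ∀ i, Differentiable ℝ (f i)) {L : ℝ≥0}
    {s : Set (EuclideanSpace ℝ (Fin d))} (hL : ∀ i, LipschitzOnWith L (∇ (f i)) s) :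
    LipschitzOnWith L (∇ (smoothPart f)) s := by
  refine LipschitzOnWith.of_dist_le_mul fun x hx y hy => ?_
  have hn' : (0 : ℝ) < n := by exact_mod_cast hn
  rw [(hasGradientAt_smoothPart hf x).gradient, (hasGradientAt_smoothPart hf y).gradient,
    dist_eq_norm, ← smul_sub, ← Finset.sum_sub_distrib, norm_smul,
    Real.norm_of_nonneg (by positivity), one_div, inv_mul_le_iff₀ hn']
  refine (norm_sum_le _ _).trans ?_
  refine (Finset.sum_le_card_nsmul _ _ (L * dist x y) fun i _ => ?_).trans_eq (by simp)
  rw [← dist_eq_norm]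
  exact (hL i).dist_le_mul x hx y hy

lemma eq_sub_smul_sum {E : Type*} [AddCommGroup E] [Module ℝ E] (a : ℝ) :
    ∀ {n : ℕ} (zi : Fin (n + 1) → E) (g : Fin n → E),
      (∀ i, zi i.succ = zi i.castSucc - a • g i) → zi (Fin.last n) = zi 0 - a • ∑ i, g i := by
  intro n
  induction n with
  | zero => intro zi g _; simp
  | succ n ih =>
    intro zi g h
    have h1 := ih (fun i => zi i.castSucc) (fun i => g i.castSucc) fun i => by
      simpa using h i.castSucc
    have h2 := h (Fin.last n)
    rw [Fin.succ_last] at h2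
    rw [h2, h1, Fin.sum_univ_castSucc, smul_add, Fin.castSucc_zero]
    abel

/-- With gradients and prox residual frozen at the start of the epoch, the inner directions sum to
`n` times the normal map for every permutation. The error `e` is the mean deviation from these
frozen directions, and it is controlled by the drift of the inner iterates. -/
lemma exists_error_of_epoch {f : Fin n → EuclideanSpace ℝ (Fin d) → ℝ} (hn : 0 < n)
    (hf : ∀ i, Differentiable ℝ (f i)) {L : ℝ≥0}
    (hL : ∀ i, LipschitzOnWith L (∇ (f i)) (dom φ)) (hp : IsProper φ)
    (hφ : IsWeaklyConvex ρ φ) (hlam : 0 < lam) (hρ : lam * ρ ≤ 1 / 4)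
    {a G : ℝ} (ha : 0 < a) (hG : ∀ i, ‖∇ (f i) w - ∇ (smoothPart f) w‖ ≤ G)
    (hsmall : 2 * (n * a) * (2 * L + 3 * lam⁻¹) ≤ 1) (σ : Equiv.Perm (Fin n))
    {zi wi : Fin (n + 1) → EuclideanSpace ℝ (Fin d)} (hz0 : zi 0 = z) (hw0 : wi 0 = w)
    (hw : w ∈ prox φ lam z)
    (hzi : ∀ i : Fin n, zi i.succ = zi i.castSucc -
      a • (∇ (f (σ i)) (wi i.castSucc) + lam⁻¹ • (zi i.castSucc - wi i.castSucc)))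
    (hwi : ∀ i : Fin n, wi i.succ ∈ prox φ lam (zi i.succ)) :
    ∃ e, zi (Fin.last n) = z - (n * a) • (normalMap (smoothPart f) lam z w + e) ∧
      ‖e‖ ≤ 2 * (2 * L + 3 * lam⁻¹) * (n * a) * (‖normalMap (smoothPart f) lam z w‖ + G) := by
  set F := normalMap (smoothPart f) lam z w with hF
  -- The prox is 2-Lipschitz: 2L comes from the gradient, 1 + 2 from `z - w`.
  set M : ℝ := 2 * L + 3 * lam⁻¹ with hM
  have hM0 : 0 < M := by positivity
  have hn' : (0 : ℝ) < n := by exact_mod_cast hn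
  have hG0 : 0 ≤ G := (norm_nonneg _).trans (hG ⟨0, hn⟩)
  have hprox : ∀ i, wi i ∈ prox φ lam (zi i) := by
    intro i
    refine Fin.cases ?_ hwi i
    rwa [hz0, hw0]
  set q : Fin n → EuclideanSpace ℝ (Fin d) := fun i =>
    ∇ (f (σ i)) (wi i.castSucc) + lam⁻¹ • (zi i.castSucc - wi i.castSucc) with hq
  set q₀ : Fin n → EuclideanSpace ℝ (Fin d) := fun i => ∇ (f (σ i)) w + lam⁻¹ • (z - w) with hq₀
  have hdiff : ∀ i, ‖q i - q₀ i‖ ≤ M * ‖zi i.castSucc - z‖ := by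
    intro i
    have h1 := norm_sub_le_of_mem_prox hp hφ hlam hρ hw (hprox i.castSucc)
    have h2 : ‖∇ (f (σ i)) (wi i.castSucc) - ∇ (f (σ i)) w‖ ≤ L * ‖wi i.castSucc - w‖ := by
      simpa [dist_eq_norm] using (hL (σ i)).dist_le_mul _ (mem_dom_of_mem_prox hp (hprox _)) _
        (mem_dom_of_mem_prox hp hw)
    have h3 : q i - q₀ i = (∇ (f (σ i)) (wi i.castSucc) - ∇ (f (σ i)) w) +
        lam⁻¹ • ((zi i.castSucc - z) - (wi i.castSucc - w)) := by
      simp only [hq, hq₀]; module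
    rw [h3]
    refine (norm_add_le _ _).trans ?_
    rw [norm_smul, Real.norm_of_nonneg (inv_pos.2 hlam).le]
    have h4 := norm_sub_le (zi i.castSucc - z) (wi i.castSucc - w)
    have h5 : lam⁻¹ * ‖(zi i.castSucc - z) - (wi i.castSucc - w)‖ ≤
        lam⁻¹ * (3 * ‖zi i.castSucc - z‖) := by gcongr; linarith
    have h6 : (L : ℝ) * ‖wi i.castSucc - w‖ ≤ L * (2 * ‖zi i.castSucc - z‖) := by gcongr
    rw [hM]
    linarith
  have hq₀le : ∀ i, ‖q₀ i‖ ≤ ‖F‖ + G := by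
    intro i
    have : q₀ i = F + (∇ (f (σ i)) w - ∇ (smoothPart f) w) := by
      simp only [hq₀, hF, normalMap]; abel
    rw [this]
    exact (norm_add_le _ _).trans (by linarith [hG (σ i)])
  set R := ‖F‖ + G with hR
  have hR0 : 0 ≤ R := by positivity
  -- `hsmall` closes the induction: as long as the bound holds, the deviation is at most `R`, so the
  -- next inner step has length at most `2 * a * R`.
  have hdist : ∀ i : Fin (n + 1), ‖zi i - z‖ ≤ 2 * i * a * R := by
    intro i
    induction i using Fin.induction with
    | zero => simp [hz0]
    | succ i ih =>
      have h1 : zi i.succ - z = (zi i.castSucc - z) - a • (q₀ i + (q i - q₀ i)) := by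
        rw [hzi i]; simp only [hq]; module
      have h2 : ‖zi i.succ - z‖ ≤ ‖zi i.castSucc - z‖ + a * (R + M * ‖zi i.castSucc - z‖) := by
        rw [h1]
        refine (norm_sub_le _ _).trans ?_
        rw [norm_smul, Real.norm_of_nonneg ha.le]
        gcongr
        exact (norm_add_le _ _).trans (add_le_add (hq₀le i) (hdiff i))
      have hin : (i : ℝ) ≤ n := by exact_mod_cast i.2.le
      simp only [Fin.val_castSucc] at ih
      have h3 : M * ‖zi i.castSucc - z‖ ≤ R := by
        calc M * ‖zi i.castSucc - z‖ ≤ M * (2 * i * a * R) := by gcongr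
          _ ≤ M * (2 * n * a * R) := by gcongr
          _ = (2 * (n * a) * M) * R := by ring
          _ ≤ 1 * R := by gcongr
          _ = R := one_mul R
      have h4 : a * (R + M * ‖zi i.castSucc - z‖) ≤ a * (R + R) := by gcongr
      simp only [Fin.val_succ]
      push_cast
      linarith
  have hsum₀ : ∑ i, q₀ i = (n : ℝ) • F := by
    have h1 : ∇ (smoothPart f) w = (1 / (n : ℝ)) • ∑ i, ∇ (f i) w :=
      (hasGradientAt_smoothPart hf w).gradient
    simp only [hq₀, hF, normalMap, Finset.sum_add_distrib, h1, smul_add, smul_smul]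
    rw [Equiv.sum_comp σ fun i => ∇ (f i) w]
    congr 1
    · field_simp
      simp
    · simp [← Nat.cast_smul_eq_nsmul ℝ, smul_smul]
  refine ⟨(1 / (n : ℝ)) • ∑ i, (q i - q₀ i), ?_, ?_⟩
  · rw [eq_sub_smul_sum a zi q hzi, hz0, Finset.sum_sub_distrib, hsum₀, smul_sub, smul_smul]
    congr 1
    rw [one_div, inv_mul_cancel₀ hn'.ne', one_smul, add_sub_cancel, smul_smul]
    congr 1
    field_simp
  · rw [norm_smul, Real.norm_of_nonneg (by positivity), one_div, inv_mul_le_iff₀ hn']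
    refine (norm_sum_le _ _).trans ?_
    refine (Finset.sum_le_card_nsmul _ _ (2 * M * (n * a) * R) fun i _ => ?_).trans_eq (by simp)
    have hin : (i : ℝ) ≤ n := by exact_mod_cast i.2.le
    have h1 := hdist i.castSucc
    simp only [Fin.val_castSucc] at h1
    calc ‖q i - q₀ i‖ ≤ M * ‖zi i.castSucc - z‖ := hdiff i
      _ ≤ M * (2 * i * a * R) := by gcongr
      _ ≤ M * (2 * n * a * R) := by gcongr
      _ = _ := by ring

end NormPRR

namespace NormPRR

open Filter

/-! ### Descent of the merit function along one inexact step -/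

section Step

variable {E : Type*} [NormedAddCommGroup E] [InnerProductSpace ℝ E]

/-- Convexity of ‖·‖² at `u` and `v / μ`. -/
lemma norm_sub_smul_add_sq_le {u v : E} {μ : ℝ} (h0 : 0 < μ) (h1 : μ ≤ 1) :
    ‖(1 - μ) • u + v‖ ^ 2 ≤ (1 - μ) * ‖u‖ ^ 2 + ‖v‖ ^ 2 / μ := by
  have h2 : ‖v‖ ^ 2 / μ * μ = ‖v‖ ^ 2 := by field_simp
  have h3 : ‖v - μ • u‖ ^ 2 = ‖v‖ ^ 2 - 2 * (μ * inner ℝ u v) + μ ^ 2 * ‖u‖ ^ 2 := by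
    rw [@norm_sub_sq_real, inner_smul_right, norm_smul, Real.norm_of_nonneg h0.le,
      real_inner_comm]
    ring
  have h4 : 0 ≤ (1 - μ) * ‖v - μ • u‖ ^ 2 := mul_nonneg (by linarith) (sq_nonneg _)
  rw [@norm_add_sq_real, inner_smul_left, norm_smul, Real.norm_of_nonneg (by linarith)]
  simp only [conj_trivial]
  refine le_of_mul_le_mul_right ?_ h0
  rw [h3] at h4
  nlinarith

variable {F F' gd e dz dw : E} {a lam L M : ℝ}

/-- Inserting `hdz` into `hF'` exposes the contraction factor 1 - a/λ on `F`, the source of descent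
in ‖F‖². Its price is a term ‖dw‖²/a. -/
lemma norm_normalMap_sq_le (ha : 0 < a) (hlam : 0 < lam) (hal : a ≤ lam)
    (hdz : dz = -(a • (F + e))) (hF' : F' = F + gd + lam⁻¹ • (dz - dw))
    (hgd : ‖gd‖ ≤ L * ‖dw‖) (hM : M = L + lam⁻¹) :
    ‖F'‖ ^ 2 ≤ (1 - a / lam) * ‖F‖ ^ 2 + 2 * lam * M ^ 2 / a * ‖dw‖ ^ 2
      + 2 * (a / lam) * ‖e‖ ^ 2 := by
  have hμ : 0 < a / lam := by positivity
  have hμ1 : a / lam ≤ 1 := (div_le_one hlam).2 hal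
  have h1 : F' = (1 - a / lam) • F + (gd - lam⁻¹ • dw - (a / lam) • e) := by
    rw [hF', hdz, div_eq_mul_inv]; module
  have h2 : ‖gd - lam⁻¹ • dw - (a / lam) • e‖ ≤ M * ‖dw‖ + a / lam * ‖e‖ := by
    refine (norm_sub_le _ _).trans (add_le_add ((norm_sub_le _ _).trans ?_) ?_)
    · rw [norm_smul, Real.norm_of_nonneg (inv_pos.2 hlam).le, hM]; linarith
    · rw [norm_smul, Real.norm_of_nonneg hμ.le]
  have h3 : ‖gd - lam⁻¹ • dw - (a / lam) • e‖ ^ 2 ≤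
      2 * (M * ‖dw‖) ^ 2 + 2 * (a / lam * ‖e‖) ^ 2 := by
    have := pow_le_pow_left₀ (norm_nonneg _) h2 2
    nlinarith [sq_nonneg (M * ‖dw‖ - a / lam * ‖e‖)]
  rw [h1]
  refine (norm_sub_smul_add_sq_le hμ hμ1).trans ?_
  have h4 : ‖gd - lam⁻¹ • dw - (a / lam) • e‖ ^ 2 / (a / lam) ≤
      (2 * (M * ‖dw‖) ^ 2 + 2 * (a / lam * ‖e‖) ^ 2) / (a / lam) := by gcongr
  have h5 : (2 * (M * ‖dw‖) ^ 2 + 2 * (a / lam * ‖e‖) ^ 2) / (a / lam) =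
      2 * lam * M ^ 2 / a * ‖dw‖ ^ 2 + 2 * (a / lam) * ‖e‖ ^ 2 := by
    field_simp
  linarith

/-- Monotonicity of the prox yields a decrease (3/4)a⁻¹‖dw‖², spent in quarters: on the price of the
contraction (`h3`, by smallness of `τ`), on the error `e` (`h6`), and on the curvature (`h10`, by
smallness of `a`). -/
lemma merit_le {B τ p p' : ℝ} (ha : 0 < a) (hlam : 0 < lam) (hal : a ≤ lam)
    (hdz : dz = -(a • (F + e))) (hF' : F' = F + gd + lam⁻¹ • (dz - dw))
    (hgd : ‖gd‖ ≤ L * ‖dw‖) (hM : M = L + lam⁻¹)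
    (hmono : 3 / 4 * ‖dw‖ ^ 2 ≤ inner ℝ dz dw)
    (hp : p' ≤ p + inner ℝ (F + lam⁻¹ • (dz - dw)) dw + B * ‖dw‖ ^ 2)
    (haB : a * (4 * (lam⁻¹ + B)) ≤ 1) (hτ0 : 0 < τ) (hτ : 4 * (τ * lam ^ 2 * M ^ 2) ≤ 1) :
    p' + τ * lam / 2 * ‖F'‖ ^ 2 ≤
      p + τ * lam / 2 * ‖F‖ ^ 2 - τ / 2 * (a * ‖F‖ ^ 2) + (1 + τ) * (a * ‖e‖ ^ 2) := by
  have h1 := mul_le_mul_of_nonneg_left (norm_normalMap_sq_le ha hlam hal hdz hF' hgd hM)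
    (show 0 ≤ τ * lam / 2 by positivity)
  have h2 : τ * lam / 2 * ((1 - a / lam) * ‖F‖ ^ 2 + 2 * lam * M ^ 2 / a * ‖dw‖ ^ 2
      + 2 * (a / lam) * ‖e‖ ^ 2) = τ * lam / 2 * ‖F‖ ^ 2 - τ / 2 * (a * ‖F‖ ^ 2) +
      a⁻¹ * (τ * lam ^ 2 * M ^ 2) * ‖dw‖ ^ 2 + τ * (a * ‖e‖ ^ 2) := by
    field_simp
  have h3 : a⁻¹ * (τ * lam ^ 2 * M ^ 2) * ‖dw‖ ^ 2 ≤ a⁻¹ * (1 / 4) * ‖dw‖ ^ 2 := by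
    gcongr; linarith
  have hFdz : F = -(a⁻¹ • dz) - e := by
    rw [hdz, smul_neg, smul_smul, inv_mul_cancel₀ ha.ne']; module
  have h4 : inner ℝ (F + lam⁻¹ • (dz - dw)) dw =
      -((a⁻¹ - lam⁻¹) * inner ℝ dz dw) - inner ℝ e dw - lam⁻¹ * ‖dw‖ ^ 2 := by
    have : F + lam⁻¹ • (dz - dw) = -((a⁻¹ - lam⁻¹) • dz) - e - lam⁻¹ • dw := by
      rw [hFdz]; module
    rw [this, inner_sub_left, inner_sub_left, inner_neg_left, inner_smul_left, inner_smul_left,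
      real_inner_self_eq_norm_sq]
    simp
  have h5 : (a⁻¹ - lam⁻¹) * (3 / 4 * ‖dw‖ ^ 2) ≤ (a⁻¹ - lam⁻¹) * inner ℝ dz dw :=
    mul_le_mul_of_nonneg_left hmono (sub_nonneg.2 (inv_anti₀ ha hal))
  have h6 : -inner ℝ e dw ≤ a * ‖e‖ ^ 2 + a⁻¹ * (1 / 4) * ‖dw‖ ^ 2 := by
    have h7 := (neg_le_abs (inner ℝ e dw)).trans (abs_real_inner_le_norm e dw)
    have h8 : 0 ≤ a * (‖e‖ - a⁻¹ * (1 / 2) * ‖dw‖) ^ 2 := by positivity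
    have h9 : a * (‖e‖ - a⁻¹ * (1 / 2) * ‖dw‖) ^ 2 =
        a * ‖e‖ ^ 2 - ‖e‖ * ‖dw‖ + a⁻¹ * (1 / 4) * ‖dw‖ ^ 2 := by
      field_simp
      ring
    linarith
  have h10 : (lam⁻¹ + B) * ‖dw‖ ^ 2 ≤ a⁻¹ * (1 / 4) * ‖dw‖ ^ 2 := by
    gcongr
    rw [le_inv_mul_iff₀ ha]
    linarith
  have h11 : 0 ≤ lam⁻¹ * ‖dw‖ ^ 2 := by positivity
  linarith

/-- Slow variation of ‖F‖², as `tendsto_of_descent` needs: here ‖dw‖ is O(a(‖F‖ + ‖e‖)), so ‖dw‖²/a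
is harmless. -/
lemma norm_normalMap_sq_le' {C : ℝ} (hC : 0 ≤ C) (ha : 0 < a) (hlam : 0 < lam) (hal : a ≤ lam)
    (hdz : dz = -(a • (F + e))) (hF' : F' = F + gd + lam⁻¹ • (dz - dw))
    (hgd : ‖gd‖ ≤ L * ‖dw‖) (hM : M = L + lam⁻¹) (hdw : ‖dw‖ ≤ 2 * ‖dz‖)
    (he : ‖e‖ ^ 2 ≤ 2 * ‖F‖ ^ 2 + C * a ^ 2) :
    ‖F'‖ ^ 2 ≤ ‖F‖ ^ 2 +
      (16 * lam * M ^ 2 + 2 / lam) * (3 + C) * (a * ‖F‖ ^ 2 + a ^ 3) := by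
  have h1 := norm_normalMap_sq_le ha hlam hal hdz hF' hgd hM
  have h2 : ‖dz‖ ≤ a * (‖F‖ + ‖e‖) := by
    rw [hdz, norm_neg, norm_smul, Real.norm_of_nonneg ha.le]
    gcongr
    exact norm_add_le _ _
  have h3 : ‖dw‖ ^ 2 ≤ 8 * a ^ 2 * (‖F‖ ^ 2 + ‖e‖ ^ 2) := by
    calc ‖dw‖ ^ 2 ≤ (2 * (a * (‖F‖ + ‖e‖))) ^ 2 := by gcongr; linarith
      _ ≤ _ := by nlinarith [mul_nonneg (sq_nonneg a) (sq_nonneg (‖F‖ - ‖e‖))]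
  have h4 : 2 * lam * M ^ 2 / a * ‖dw‖ ^ 2 ≤ 16 * lam * M ^ 2 * (a * (‖F‖ ^ 2 + ‖e‖ ^ 2)) := by
    calc _ ≤ 2 * lam * M ^ 2 / a * (8 * a ^ 2 * (‖F‖ ^ 2 + ‖e‖ ^ 2)) := by gcongr
      _ = _ := by field_simp; ring
  have h5 : 0 ≤ a / lam * ‖F‖ ^ 2 := by positivity
  have h6 : 2 * (a / lam) * ‖e‖ ^ 2 ≤ 2 / lam * (a * (‖F‖ ^ 2 + ‖e‖ ^ 2)) := by
    have : 2 / lam * (a * (‖F‖ ^ 2 + ‖e‖ ^ 2)) =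
      2 * (a / lam) * ‖e‖ ^ 2 + 2 * (a / lam * ‖F‖ ^ 2) := by ring
    linarith
  have h7 : ‖F‖ ^ 2 + ‖e‖ ^ 2 ≤ 3 * ‖F‖ ^ 2 + C * a ^ 2 := by linarith
  have h8 : a * (‖F‖ ^ 2 + ‖e‖ ^ 2) ≤ (3 + C) * (a * ‖F‖ ^ 2 + a ^ 3) := by
    have h9 := mul_le_mul_of_nonneg_left h7 ha.le
    have h10 : 0 ≤ C * (a * ‖F‖ ^ 2) := by positivity
    have h11 : 0 ≤ a ^ 3 := by positivity
    nlinarith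
  have h12 : (16 * lam * M ^ 2 + 2 / lam) * (a * (‖F‖ ^ 2 + ‖e‖ ^ 2)) ≤
      (16 * lam * M ^ 2 + 2 / lam) * ((3 + C) * (a * ‖F‖ ^ 2 + a ^ 3)) := by gcongr
  have h13 : (1 - a / lam) * ‖F‖ ^ 2 = ‖F‖ ^ 2 - a / lam * ‖F‖ ^ 2 := by ring
  linarith

end Step

end NormPRR

namespace NormPRR

open Filter

variable {d : ℕ} {φ : EuclideanSpace ℝ (Fin d) → EReal} {ρ lam : ℝ}
  {h : EuclideanSpace ℝ (Fin d) → ℝ}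

/-! ### Inexact normal map steps -/

/-- Limits of proximal points along which the normal map vanishes are stationary, and the
objective is continuous along such sequences. -/
lemma mem_crit_of_tendsto (hh : Differentiable ℝ h) {L : ℝ≥0}
    (hL : LipschitzOnWith L (∇ h) (dom φ)) (hp : IsProper φ) (hφ : IsWeaklyConvex ρ φ)
    (hlsc : LowerSemicontinuous φ) (hlam : 0 < lam)
    {z w : ℕ → EuclideanSpace ℝ (Fin d)} {x : EuclideanSpace ℝ (Fin d)} {p : ℝ}
    (hw : ∀ k, w k ∈ prox φ lam (z k)) (hx : Tendsto w atTop (𝓝 x))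
    (hF : Tendsto (fun k => normalMap h lam (z k) (w k)) atTop (𝓝 0))
    (hψ : Tendsto (fun k => h (w k) + (φ (w k)).toReal) atTop (𝓝 p)) :
    x ∈ dom φ ∧ h x + (φ x).toReal = p ∧ x ∈ crit (fun y => (h y : EReal) + φ y) := by
  have hwd : ∀ k, w k ∈ dom φ := fun k => mem_dom_of_mem_prox hp (hw k)
  have hhx : Tendsto (fun k => h (w k)) atTop (𝓝 (h x)) :=
    (hh.continuous.tendsto x).comp hx
  have hφx : Tendsto (fun k => (φ (w k)).toReal) atTop (𝓝 (p - h x)) :=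
    (hψ.sub hhx).congr fun k => by ring
  have hle : φ x ≤ ((p - h x : ℝ) : EReal) := by
    by_contra! hlt
    obtain ⟨c, hc1, hc2⟩ := EReal.lt_iff_exists_real_btwn.1 hlt
    have hev : ∀ᶠ k in atTop, c ≤ (φ (w k)).toReal := by
      filter_upwards [hx.eventually (hlsc x c hc2)] with k hk
      rw [← hp.coe_toReal (hwd k)] at hk
      exact_mod_cast hk.le
    have h1 := ge_of_tendsto hφx hev
    exact absurd (EReal.coe_lt_coe_iff.1 hc1) (not_lt.2 h1)
  have hxd : x ∈ dom φ := mem_dom_of_le_coe hle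
  have hgrad : Tendsto (fun k => ∇ h (w k)) atTop (𝓝 (∇ h x)) := by
    have h1 : ContinuousWithinAt (∇ h) (dom φ) x := hL.continuousOn x hxd
    exact h1.tendsto.comp (tendsto_nhdsWithin_iff.2 ⟨hx, Eventually.of_forall hwd⟩)
  have hsub : Tendsto (fun k => lam⁻¹ • (z k - w k)) atTop (𝓝 (-∇ h x)) := by
    have := hF.sub hgrad
    rw [zero_sub] at this
    refine this.congr fun k => ?_
    simp [normalMap]
  -- Used twice: y = x gives the inequality converse to `hle`, and general y makes `-∇ h x` a
  -- proximal subgradient.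
  have hineq : ∀ y ∈ dom φ, p - h x + inner ℝ (-∇ h x) (y - x) - ρ / 2 * ‖y - x‖ ^ 2 ≤
      (φ y).toReal := by
    intro y hy
    have hyx : Tendsto (fun k => y - w k) atTop (𝓝 (y - x)) := tendsto_const_nhds.sub hx
    exact le_of_tendsto' ((hφx.add (hsub.inner hyx)).sub ((hyx.norm.pow 2).const_mul (ρ / 2)))
      fun k => le_toReal_of_mem_prox hp hφ hlam (hw k) hy
  have heq : (φ x).toReal = p - h x := by
    refine le_antisymm (hp.toReal_le hle) ?_
    simpa using hineq x hxd
  have hmem := add_mem_subdiff (g := -∇ h x) (ρ := ρ) (hh x).hasGradientAt hp hxd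
    fun y hy => heq ▸ hineq y hy
  rw [add_neg_cancel] at hmem
  exact ⟨hxd, by rw [heq]; ring, hmem.1, hmem⟩

/-- Transfers the KL inequality from ψ to the merit function: t ^ θ is subadditive, and θ ≥ 1/2 with
y ≤ 1 makes (y²) ^ θ at most y. -/
lemma rpow_add_sq_add_le {t κ y v B θ : ℝ} (ht : 0 ≤ t) (hκ : 0 ≤ κ) (hy : 0 ≤ y) (hy1 : y ≤ 1)
    (hv : 0 ≤ v) (hθ : 1 / 2 ≤ θ) (hθ1 : θ < 1) (h : t ^ θ ≤ B * y) :
    (t + κ * y ^ 2 + v) ^ θ ≤ (B + κ ^ θ) * y + v ^ θ := by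
  have hθ0 : 0 < θ := by linarith
  have h0 : 0 ≤ κ * y ^ 2 := by positivity
  have h1 : (κ * y ^ 2) ^ θ ≤ κ ^ θ * y := by
    rw [Real.mul_rpow hκ (sq_nonneg _)]
    refine mul_le_mul_of_nonneg_left ?_ (Real.rpow_nonneg hκ _)
    rw [← Real.rpow_natCast, ← Real.rpow_mul hy]
    rcases hy.eq_or_lt with h0 | h0
    · rw [← h0, Real.zero_rpow (by push_cast; positivity)]
    · refine (Real.rpow_le_rpow_of_exponent_ge (y := _) (z := 1) h0 hy1 ?_).trans_eq
        (Real.rpow_one _)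
      push_cast
      linarith
  calc _ ≤ (t + κ * y ^ 2) ^ θ + v ^ θ :=
        Real.rpow_add_le_add_rpow (by positivity) hv hθ0.le hθ1.le
    _ ≤ t ^ θ + (κ * y ^ 2) ^ θ + v ^ θ := by
        gcongr
        exact Real.rpow_add_le_add_rpow ht h0 hθ0.le hθ1.le
    _ ≤ _ := by linarith

set_option maxHeartbeats 1000000 in
/-- Finite length and convergence of the inexact normal map iteration under the KL property. -/
theorem summable_and_tendsto_of_inexact_steps (hh : Differentiable ℝ h) {L : ℝ≥0}
    (hL : LipschitzOnWith L (∇ h) (dom φ)) (hp : IsProper φ)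
    (hφ : IsWeaklyConvex ρ φ) (hlsc : LowerSemicontinuous φ) (hlam : 0 < lam)
    (hlamρ : lam * ρ ≤ 1 / 4) {m : ℝ} (hm : ∀ y ∈ dom φ, m ≤ h y + (φ y).toReal)
    {z w e : ℕ → EuclideanSpace ℝ (Fin d)} {a : ℕ → ℝ} {A b γ C M τ R : ℝ}
    (hA : 0 < A) (hb : 1 ≤ b) (hγ : 1 / 2 < γ) (hγ' : γ ≤ 1)
    (ha : ∀ k, a k = A * (b + k) ^ (-γ)) (hC : 0 ≤ C) (hM : M = L + lam⁻¹) (hτ0 : 0 < τ)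
    (hτ : 4 * (τ * lam ^ 2 * M ^ 2) ≤ 1) (halam : ∀ k, a k ≤ lam)
    (haB : ∀ k, a k * (4 * (lam⁻¹ + (L + ρ) / 2)) ≤ 1) (haC : ∀ k, C * a k ≤ 1)
    (haτ : ∀ k, (1 + τ) * (2 * C ^ 2 * a k ^ 2) ≤ τ / 4)
    (hw : ∀ k, w k ∈ prox φ lam (z k))
    (hz : ∀ k, z (k + 1) = z k - a k • (normalMap h lam (z k) (w k) + e k))
    (he : ∀ k, ‖e k‖ ≤ C * a k * (‖normalMap h lam (z k) (w k)‖ + 1))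
    (hbdd : ∀ k, ‖w k‖ ≤ R)
    (hKL : ∀ x ∈ accPts w, x ∈ dom φ → HasKL (fun y => (h y : EReal) + φ y) x) :
    Summable (fun k => ‖w (k + 1) - w k‖) ∧
      ∃ x ∈ crit (fun y => (h y : EReal) + φ y), Tendsto w atTop (𝓝 x) := by
  set F : ℕ → EuclideanSpace ℝ (Fin d) := fun k => normalMap h lam (z k) (w k) with hFdef
  set p : ℕ → ℝ := fun k => h (w k) + (φ (w k)).toReal with hpdef
  have hwd : ∀ k, w k ∈ dom φ := fun k => mem_dom_of_mem_prox hp (hw k)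
  have hbk : ∀ k : ℕ, 1 ≤ b + k := fun k => by
    have : (0 : ℝ) ≤ k := k.cast_nonneg
    linarith
  have hbk0 : ∀ k : ℕ, 0 < b + k := fun k => by linarith [hbk k]
  have hapos : ∀ k, 0 < a k := fun k => by
    rw [ha]; exact mul_pos hA (Real.rpow_pos_of_pos (hbk0 k) _)
  have hdz : ∀ k, z (k + 1) - z k = -(a k • (F k + e k)) := fun k => by
    rw [hz k, sub_sub_cancel_left]
  have hF' : ∀ k, F (k + 1) = F k + (∇ h (w (k + 1)) - ∇ h (w k)) +
      lam⁻¹ • ((z (k + 1) - z k) - (w (k + 1) - w k)) := fun k => by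
    simp only [hFdef, normalMap]; module
  have hgd : ∀ k, ‖∇ h (w (k + 1)) - ∇ h (w k)‖ ≤ L * ‖w (k + 1) - w k‖ := fun k => by
    simpa [dist_eq_norm] using hL.dist_le_mul _ (hwd (k + 1)) _ (hwd k)
  have hdw : ∀ k, ‖w (k + 1) - w k‖ ≤ 2 * ‖z (k + 1) - z k‖ := fun k =>
    norm_sub_le_of_mem_prox hp hφ hlam hlamρ (hw k) (hw (k + 1))
  have hmono : ∀ k, 3 / 4 * ‖w (k + 1) - w k‖ ^ 2 ≤
      inner ℝ (z (k + 1) - z k) (w (k + 1) - w k) := fun k => by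
    have := inner_ge_of_mem_prox hp hφ hlam (hw k) (hw (k + 1))
    nlinarith [sq_nonneg ‖w (k + 1) - w k‖]
  -- The descent lemma is based at `w k`, but the proximal inequality at `w (k + 1)`; hence the
  -- shift of `F k`.
  have hpstep : ∀ k, p (k + 1) ≤ p k + inner ℝ (F k + lam⁻¹ • ((z (k + 1) - z k) -
      (w (k + 1) - w k))) (w (k + 1) - w k) + (L + ρ) / 2 * ‖w (k + 1) - w k‖ ^ 2 := fun k => by
    have h1 := le_add_of_lipschitzOnWith_gradient hh (hφ.convex_dom hp) hL (hwd k) (hwd (k + 1))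
    have h2 := le_toReal_of_mem_prox hp hφ hlam (hw (k + 1)) (hwd k)
    rw [norm_sub_rev, ← neg_sub (w (k + 1)) (w k), inner_neg_right] at h2
    have h3 : F k + lam⁻¹ • ((z (k + 1) - z k) - (w (k + 1) - w k)) =
        ∇ h (w k) + lam⁻¹ • (z (k + 1) - w (k + 1)) := by
      simp only [hFdef, normalMap]; module
    rw [h3, inner_add_left]
    simp only [hpdef]
    linarith
  have hesq : ∀ k, ‖e k‖ ^ 2 ≤ 2 * C ^ 2 * a k ^ 2 * (‖F k‖ ^ 2 + 1) := fun k => by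
    calc ‖e k‖ ^ 2 ≤ (C * a k * (‖F k‖ + 1)) ^ 2 := pow_le_pow_left₀ (norm_nonneg _) (he k) 2
      _ ≤ _ := by nlinarith [mul_nonneg (sq_nonneg (C * a k)) (sq_nonneg (‖F k‖ - 1))]
  have hCa1 : ∀ k, C ^ 2 * a k ^ 2 ≤ 1 := fun k => by
    rw [← mul_pow]
    exact pow_le_one₀ (mul_nonneg hC (hapos k).le) (haC k)
  have hesq' : ∀ k, ‖e k‖ ^ 2 ≤ 2 * ‖F k‖ ^ 2 + 2 * C ^ 2 * a k ^ 2 := fun k => by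
    nlinarith [hesq k, hCa1 k, sq_nonneg ‖F k‖]
  set H : ℕ → ℝ := fun k => p k + τ * lam / 2 * ‖F k‖ ^ 2 with hHdef
  set C₁ : ℝ := (1 + τ) * (2 * C ^ 2) with hC₁
  have hC₁0 : 0 ≤ C₁ := by positivity
  -- By `haτ`, the ‖F‖² part of the error costs half of the decrease, τ/2 becoming τ/4.
  have hH : ∀ k, H (k + 1) ≤ H k - τ / 4 * (a k * ‖F k‖ ^ 2) + C₁ * a k ^ 3 := fun k => by
    have h1 := merit_le (hapos k) hlam (halam k) (hdz k) (hF' k) (hgd k) hM (hmono k) (hpstep k)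
      (haB k) hτ0 hτ
    have h2 : (1 + τ) * (a k * ‖e k‖ ^ 2) ≤
        (1 + τ) * (a k * (2 * C ^ 2 * a k ^ 2 * (‖F k‖ ^ 2 + 1))) := by
      have := hapos k
      gcongr
      exact hesq k
    have h3 := mul_le_mul_of_nonneg_right (haτ k)
      (mul_nonneg (hapos k).le (sq_nonneg ‖F k‖))
    simp only [hHdef, hC₁]
    linarith
  have hcube : ∀ k, a k ^ 3 = A ^ 3 * (b + k) ^ (-(3 * γ)) := fun k => by
    rw [ha, mul_pow, ← Real.rpow_natCast ((b + k) ^ (-γ)), ← Real.rpow_mul (hbk0 k).le]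
    congr 2
    push_cast
    ring
  have hcub : Summable fun k => a k ^ 3 := by
    simp_rw [hcube]
    exact ((summable_rpow_neg_iff (by linarith) _).2 (by linarith)).mul_left _
  have hns : ¬ Summable a := by
    intro hs
    have : Summable fun k : ℕ => (b + k) ^ (-γ) := by
      refine (hs.mul_left A⁻¹).congr fun k => ?_
      rw [ha, inv_mul_cancel_left₀ hA.ne']
    exact absurd ((summable_rpow_neg_iff (by linarith) γ).1 this) (not_lt.2 hγ')
  obtain ⟨hy0, l, hl⟩ := tendsto_of_descent (H := H) (y := fun k => ‖F k‖) (a := a)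
    (by positivity) hC₁0 hapos hns hcub (fun k => norm_nonneg _)
    (m := m) (fun k => by
      have : 0 ≤ τ * lam / 2 * ‖F k‖ ^ 2 := by positivity
      simp only [hHdef]
      linarith [hm _ (hwd k)])
    hH (fun k => norm_normalMap_sq_le' (by positivity) (hapos k) hlam (halam k) (hdz k) (hF' k)
      (hgd k) hM (hdw k) (hesq' k))
  have hF0 : Tendsto F atTop (𝓝 0) := tendsto_zero_iff_norm_tendsto_zero.2 hy0
  have hpl : Tendsto p atTop (𝓝 l) := by
    have := hl.sub ((hy0.pow 2).const_mul (τ * lam / 2))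
    simpa [hHdef] using this
  obtain ⟨x, -, s, hs, hsx⟩ := tendsto_subseq_of_bounded (x := w) (s := Metric.closedBall 0 R)
    Metric.isBounded_closedBall fun k => by simpa using hbdd k
  obtain ⟨hxd, hxl, hxcrit⟩ := mem_crit_of_tendsto hh hL hp hφ hlsc hlam
    (z := z ∘ s) (w := w ∘ s) (fun k => hw (s k)) hsx (hF0.comp hs.tendsto_atTop)
    (hpl.comp hs.tendsto_atTop)
  have hψcoe : ∀ y ∈ dom φ, (h y : EReal) + φ y = ((h y + (φ y).toReal : ℝ) : EReal) :=
    fun y hy => by rw [EReal.coe_add, hp.coe_toReal hy]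
  -- The tails of ∑ a³ have order k^(-q). The requirement γ + qθ > 1 makes ∑ a v^θ finite.
  set q : ℝ := 3 * γ - 1 with hq
  have hq0 : 0 < q := by linarith
  have hq1 : (1 - γ) / q < 1 := by rw [div_lt_one hq0]; linarith
  obtain ⟨θ₁, hθ₁, hθ₁'⟩ := exists_between hq1
  obtain ⟨θ, B, r, δ, hθ2, hθθ, hθ1, hB, hr, hδ, hKLx⟩ :=
    (hKL x ⟨s, hs, hsx⟩ hxd).exists_rpow_le (p := l) (by rw [hψcoe x hxd, hxl]) hθ₁'
  have hθ0 : 0 < θ := by linarith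
  have hqθ : 1 < γ + q * θ := by
    have := (div_lt_iff₀ hq0).1 (hθ₁.trans_le hθθ)
    linarith
  set V : ℝ := C₁ * A ^ 3 / (q * 2 ^ (-(q + 1))) with hV
  have h2q : (0 : ℝ) < 2 ^ (-(q + 1)) := Real.rpow_pos_of_pos (by norm_num) _
  have hV0 : 0 ≤ V := by positivity
  set v : ℕ → ℝ := fun k => V * (b + k) ^ (-q) with hvdef
  have hv0 : ∀ k, 0 ≤ v k := fun k => mul_nonneg hV0 (Real.rpow_pos_of_pos (hbk0 k) _).le
  have hvstep : ∀ k, C₁ * a k ^ 3 ≤ v k - v (k + 1) := fun k => by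
    have h1 := mul_le_mul_of_nonneg_left (rpow_neg_sub_rpow_neg_le hq0 (hbk k)) hV0
    have h2 : V * (q * 2 ^ (-(q + 1)) * (b + k) ^ (-(q + 1))) =
        C₁ * (A ^ 3 * (b + k) ^ (-(q + 1))) := by
      rw [hV]; field_simp
    rw [h2, show -(q + 1) = -(3 * γ) by rw [hq]; ring, ← hcube] at h1
    simp only [hvdef]
    push_cast
    rw [← add_assoc]
    linarith
  have hvlim : Tendsto v atTop (𝓝 0) := by
    have h1 : Tendsto (fun k : ℕ => b + (k : ℝ)) atTop atTop :=
      tendsto_atTop_add_const_left _ _ tendsto_natCast_atTop_atTop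
    simpa using ((tendsto_rpow_neg_atTop hq0).comp h1).const_mul V
  set E : ℕ → ℝ := fun k => H k - l + v k with hEdef
  have hEstep : ∀ k, E (k + 1) ≤ E k - τ / 4 * (a k * ‖F k‖ ^ 2) := fun k => by
    simp only [hEdef]
    linarith [hH k, hvstep k]
  have hEanti : Antitone E := antitone_nat_of_succ_le fun k => by
    have : 0 ≤ τ / 4 * (a k * ‖F k‖ ^ 2) := by have := hapos k; positivity
    linarith [hEstep k]
  have hElim : Tendsto E atTop (𝓝 0) := by
    simpa using (hl.sub_const l).add hvlim
  have hE0 : ∀ k, 0 ≤ E k := fun k => hEanti.le_of_tendsto hElim k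
  set B' : ℝ := B + (τ * lam / 2) ^ θ with hB'
  have hτlθ : 0 ≤ (τ * lam / 2) ^ θ := Real.rpow_nonneg (by positivity) _
  have hB'0 : 0 < B' := by positivity
  set K : ℝ := 2 * B' / ((1 - θ) * (τ / 4)) with hK
  have hK0 : 0 ≤ K := by
    have : 0 < 1 - θ := by linarith
    positivity
  -- From ‖dw‖ ≤ 2‖dz‖ and ‖dz‖ ≤ a(2‖F‖ + C a), with a‖F‖ bounded through KL.
  set bd : ℕ → ℝ := fun k => 4 * (K * (E k ^ (1 - θ) - E (k + 1) ^ (1 - θ)) +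
    a k * v k ^ θ / B') + 2 * C * a k ^ 2 with hbd
  have hEθanti : Antitone fun k => E k ^ (1 - θ) := fun i j hij =>
    Real.rpow_le_rpow (hE0 j) (hEanti hij) (by linarith)
  have hbd0 : ∀ k, 0 ≤ bd k := fun k => by
    have h1 : 0 ≤ E k ^ (1 - θ) - E (k + 1) ^ (1 - θ) := sub_nonneg.2 (hEθanti k.le_succ)
    have h2 := Real.rpow_nonneg (hv0 k) θ
    have h3 := hapos k
    positivity
  have hav : Summable fun k => a k * v k ^ θ := by
    have h1 : ∀ k : ℕ, A * V ^ θ * (b + k) ^ (-(γ + q * θ)) = a k * v k ^ θ := fun k => by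
      rw [ha]
      simp only [hvdef]
      rw [Real.mul_rpow hV0 (Real.rpow_nonneg (hbk0 k).le _), ← Real.rpow_mul (hbk0 k).le,
        neg_add, Real.rpow_add (hbk0 k), neg_mul]
      ring
    exact (((summable_rpow_neg_iff (by linarith) _).2 hqθ).mul_left _).congr h1
  have hasq : Summable fun k => a k ^ 2 := by
    have h1 : ∀ k : ℕ, A ^ 2 * (b + k) ^ (-(2 * γ)) = a k ^ 2 := fun k => by
      rw [ha, mul_pow, ← Real.rpow_natCast ((b + k) ^ (-γ)), ← Real.rpow_mul (hbk0 k).le]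
      congr 2
      push_cast
      ring
    exact (((summable_rpow_neg_iff (by linarith) _).2 (by linarith)).mul_left _).congr h1
  have hbds : Summable bd := by
    refine Summable.add (((Summable.mul_left _ ?_).add (hav.div_const _)).mul_left _)
      (hasq.mul_left _)
    exact summable_sub_of_antitone (fun k => Real.rpow_nonneg (hE0 k) _) hEθanti
  have hsum : Summable fun k => ‖w (k + 1) - w k‖ := by
    have hcl : MapClusterPt x atTop w := hsx.mapClusterPt.of_comp hs.tendsto_atTop
    refine summable_norm_sub_of_local hr hbds hbd0 hcl ?_
    have hev1 : ∀ᶠ k in atTop, |p k - l| < δ := by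
      have := hpl.eventually (Metric.ball_mem_nhds l hδ)
      simpa [Metric.mem_ball, Real.dist_eq] using this
    have hev2 : ∀ᶠ k in atTop, ‖F k‖ ≤ 1 := hy0.eventually (ge_mem_nhds one_pos)
    filter_upwards [hev1, hev2] with k hk1 hk2 hkr
    have hFsub : F k ∈ subdiff (fun y => (h y : EReal) + φ y) (w k) :=
      add_mem_subdiff (hh (w k)).hasGradientAt hp (hwd k)
        fun y hy => le_toReal_of_mem_prox hp hφ hlam (hw k) hy
    have hk := hKLx (w k) hkr (p k) (hψcoe _ (hwd k)) hk1 (F k) hFsub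
    have hEθ : E k ^ θ ≤ B' * ‖F k‖ + v k ^ θ := by
      refine le_trans (Real.rpow_le_rpow (hE0 k) ?_ hθ0.le) (rpow_add_sq_add_le (abs_nonneg _)
        (show 0 ≤ τ * lam / 2 by positivity) (norm_nonneg _) hk2 (hv0 k) hθ2 hθ1 hk)
      simp only [hEdef, hHdef]
      linarith [le_abs_self (p k - l)]
    have haF := mul_le_of_rpow_le (hE0 k) (hE0 (k + 1)) (hapos k) (norm_nonneg (F k)) hB'0
      (Real.rpow_nonneg (hv0 k) θ) (by positivity) hθ0.le hθ1 (hEstep k) hEθ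
    have hdzk : ‖z (k + 1) - z k‖ ≤ a k * (2 * ‖F k‖ + C * a k) := by
      rw [hdz k, norm_neg, norm_smul, Real.norm_of_nonneg (hapos k).le]
      refine mul_le_mul_of_nonneg_left ((norm_add_le _ _).trans ?_) (hapos k).le
      linarith [he k, mul_le_of_le_one_left (norm_nonneg (F k)) (haC k)]
    have h2 : 2 * (a k * (2 * ‖F k‖ + C * a k)) = 4 * (a k * ‖F k‖) + 2 * C * a k ^ 2 := by ring
    simp only [hbd]
    linarith [hdw k]
  have hcau : CauchySeq w := by
    refine cauchySeq_of_summable_dist (hsum.congr fun k => ?_)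
    rw [dist_comm, dist_eq_norm]
  exact ⟨hsum, x, hxcrit, tendsto_nhds_of_cauchySeq_of_subseq hcau hs.tendsto_atTop hsx⟩

end NormPRR

/-! ### Reduction of random reshuffling to inexact normal map steps -/

namespace NormPRR

open Filter

lemma IsNormPRR.mem_prox {n d : ℕ} {f : Fin n → EuclideanSpace ℝ (Fin d) → ℝ}
    {φ : EuclideanSpace ℝ (Fin d) → EReal} {lam : ℝ} {α : ℕ → ℝ} {π : ℕ → Equiv.Perm (Fin n)}
    {z w : ℕ → EuclideanSpace ℝ (Fin d)} (h : IsNormPRR f φ lam α π z w) (hn : 0 < n) {k : ℕ}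
    (hk : 1 ≤ k) : w k ∈ prox φ lam (z k) := by
  induction k, hk using Nat.le_induction with
  | base => exact h.init
  | succ k hk _ =>
    obtain ⟨zi, wi, -, -, hstep, hz, hw⟩ := h.epoch k hk
    obtain ⟨i, hi⟩ : ∃ i : Fin n, i.succ = Fin.last n :=
      Fin.exists_succ_eq.2 (by simp [Fin.ext_iff, hn.ne'])
    rw [hz, hw, ← hi]
    exact (hstep i).2

/-- On bounded subsets of the domain, the component gradients deviate boundedly from the mean. -/
lemma exists_norm_gradient_sub_le {n d : ℕ} (hn : 0 < n)
    {f : Fin n → EuclideanSpace ℝ (Fin d) → ℝ} (hf : ∀ i, Differentiable ℝ (f i)) {L : ℝ≥0}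
    {s : Set (EuclideanSpace ℝ (Fin d))} (hL : ∀ i, LipschitzOnWith L (∇ (f i)) s)
    (hs : s.Nonempty) (R : ℝ) :
    ∃ G : ℝ, 1 ≤ G ∧ ∀ w ∈ s, ‖w‖ ≤ R → ∀ i, ‖∇ (f i) w - ∇ (smoothPart f) w‖ ≤ G := by
  obtain ⟨x, hx⟩ := hs
  have hL' := lipschitzOnWith_gradient_smoothPart hn hf hL
  refine ⟨max 1 (∑ i, ‖∇ (f i) x - ∇ (smoothPart f) x‖ + 2 * (L * (R + ‖x‖))), le_max_left _ _,
    fun w hw hwR i => le_trans ?_ (le_max_right _ _)⟩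
  have h1 : ‖∇ (f i) w - ∇ (f i) x‖ ≤ L * ‖w - x‖ := by
    simpa [dist_eq_norm] using (hL i).dist_le_mul _ hw _ hx
  have h2 : ‖∇ (smoothPart f) w - ∇ (smoothPart f) x‖ ≤ L * ‖w - x‖ := by
    simpa [dist_eq_norm] using hL'.dist_le_mul _ hw _ hx
  have h3 : ‖∇ (f i) x - ∇ (smoothPart f) x‖ ≤ ∑ i, ‖∇ (f i) x - ∇ (smoothPart f) x‖ :=
    Finset.single_le_sum (f := fun i => ‖∇ (f i) x - ∇ (smoothPart f) x‖)
      (fun i _ => norm_nonneg _) (Finset.mem_univ i)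
  have h4 : (L : ℝ) * ‖w - x‖ ≤ L * (R + ‖x‖) := by
    gcongr
    exact (norm_sub_le _ _).trans (by linarith)
  calc ‖∇ (f i) w - ∇ (smoothPart f) w‖ = ‖(∇ (f i) x - ∇ (smoothPart f) x) +
        ((∇ (f i) w - ∇ (f i) x) - (∇ (smoothPart f) w - ∇ (smoothPart f) x))‖ := by
        congr 1; abel
    _ ≤ _ := norm_add_le _ _
    _ ≤ _ := by linarith [norm_sub_le (∇ (f i) w - ∇ (f i) x)
                  (∇ (smoothPart f) w - ∇ (smoothPart f) x)]

lemma le_smoothPart {n d : ℕ} (hn : 0 < n) {f : Fin n → EuclideanSpace ℝ (Fin d) → ℝ}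
    {x : EuclideanSpace ℝ (Fin d)} {m : ℝ} (h : ∀ i, m ≤ f i x) : m ≤ smoothPart f x := by
  have hn' : (0 : ℝ) < n := by exact_mod_cast hn
  have h1 := Finset.card_nsmul_le_sum Finset.univ (fun i => f i x) m fun i _ => h i
  rw [Finset.card_univ, Fintype.card_fin, nsmul_eq_mul] at h1
  rw [smoothPart, one_div, le_inv_mul_iff₀ hn']
  exact h1

end NormPRR

set_option maxHeartbeats 1000000 in
theorem corollary23 {n d : ℕ} (hn : 0 < n)
    (f : Fin n → EuclideanSpace ℝ (Fin d) → ℝ) (φ : EuclideanSpace ℝ (Fin d) → EReal)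
    (hf : ∀ i, Differentiable ℝ (f i))
    -- the gradients are Lipschitz on the domain of `φ`
    (L : ℝ≥0) (hL : 0 < L) (hLip : ∀ i, LipschitzOnWith L (∇ (f i)) (NormPRR.dom φ))
    -- `φ` is `ρ`-weakly convex, lower semicontinuous and proper
    (ρ : ℝ) (hρ : 0 < ρ) (hφ : NormPRR.IsWeaklyConvex ρ φ) (hlsc : LowerSemicontinuous φ)
    (hproper : NormPRR.IsProper φ)
    -- lower bounds on the domain of `φ`
    (flb φlb : ℝ) (hflb : ∀ i, ∀ x ∈ NormPRR.dom φ, flb ≤ f i x)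
    (hφlb : ∀ x ∈ NormPRR.dom φ, (φlb : EReal) ≤ φ x)
    -- the method with polynomial step sizes
    (lam : ℝ) (hlam : 0 < lam) (hlam' : lam < 1 / (4 * ρ))
    (α β γ : ℝ) (hα : 0 < α) (hβ : 0 ≤ β) (hγ : 1 / 2 < γ) (hγ' : γ ≤ 1)
    (π : ℕ → Equiv.Perm (Fin n)) (z w : ℕ → EuclideanSpace ℝ (Fin d))
    (hw : NormPRR.IsNormPRR f φ lam (fun k => α / (β + (k : ℝ)) ^ γ) π z w)
    -- the iterates are bounded, and the KL property holds on the set of accumulation points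
    (hbdd : ∃ M : ℝ, ∀ k : ℕ, 1 ≤ k → ‖w k‖ ≤ M)
    (hKL : ∀ x ∈ NormPRR.accPts w, x ∈ NormPRR.dom φ →
      NormPRR.HasKL (NormPRR.objective f φ) x) :
    Summable (fun k : ℕ => ‖w (k + 2) - w (k + 1)‖) ∧
      ∃ wstar ∈ NormPRR.crit (NormPRR.objective f φ),
        Filter.Tendsto w Filter.atTop (𝓝 wstar) := by
  open NormPRR Filter in
  obtain ⟨R, hR⟩ := hbdd
  have hn' : (0 : ℝ) < n := by exact_mod_cast hn
  have hlamρ : lam * ρ ≤ 1 / 4 := by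
    rw [lt_div_iff₀ (by positivity)] at hlam'
    linarith
  have hprox : ∀ k, 1 ≤ k → w k ∈ prox φ lam (z k) := fun k hk => hw.mem_prox hn hk
  obtain ⟨G, hG1, hG⟩ := exists_norm_gradient_sub_le hn hf hLip hproper.2 R
  set M₀ : ℝ := 2 * L + 3 * lam⁻¹ with hM₀
  have hM₀0 : 0 < M₀ := by positivity
  set C : ℝ := 2 * M₀ * G with hC
  set M : ℝ := L + lam⁻¹ with hM
  have hM0 : 0 < M := by positivity
  set τ : ℝ := 1 / (4 * (lam ^ 2 * M ^ 2)) with hτ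
  have hτ0 : 0 < τ := by positivity
  set s : ℕ → ℝ := fun k => n * (α / (β + (k : ℝ)) ^ γ) with hs
  have hslim : Tendsto s atTop (𝓝 0) := by
    have h1 : Tendsto (fun k : ℕ => β + (k : ℝ)) atTop atTop :=
      tendsto_atTop_add_const_left _ _ tendsto_natCast_atTop_atTop
    have h2 := ((tendsto_rpow_atTop (by linarith : 0 < γ)).comp h1).const_div_atTop α
    simpa using h2.const_mul (n : ℝ)
  have hsmall : ∀ c ε : ℝ, 0 < ε → ∀ᶠ k in atTop, c * s k ≤ ε := fun c ε hε => by
    have h1 := hslim.const_mul c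
    rw [mul_zero] at h1
    exact h1.eventually (ge_mem_nhds hε)
  have hsmall2 : ∀ᶠ k in atTop, (1 + τ) * (2 * C ^ 2 * s k ^ 2) ≤ τ / 4 := by
    have h1 := ((hslim.pow 2).const_mul (2 * C ^ 2)).const_mul (1 + τ)
    rw [zero_pow two_ne_zero, mul_zero, mul_zero] at h1
    exact h1.eventually (ge_mem_nhds (by positivity))
  -- The step size restrictions hold only eventually; dropping finitely many epochs affects neither
  -- finite length nor the limit. Taking `N ≥ 1` also skips the meaningless index 0 and gives `β + N
  -- ≥ 1`.
  obtain ⟨N, hN⟩ := eventually_atTop.1 ((eventually_ge_atTop 1).and <|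
    (hsmall 1 lam hlam).and <| (hsmall (4 * (lam⁻¹ + (L + ρ) / 2)) 1 one_pos).and <|
    (hsmall C 1 one_pos).and <| (hsmall (2 * M₀) 1 one_pos).and hsmall2)
  have hN1 : ∀ k, 1 ≤ k + N := fun k => (hN N le_rfl).1.trans (Nat.le_add_left _ _)
  have hNk : ∀ k, N ≤ k + N := fun k => Nat.le_add_left _ _
  have herr : ∀ k, ∃ e, z (k + N + 1) =
      z (k + N) - s (k + N) • (normalMap (smoothPart f) lam (z (k + N)) (w (k + N)) + e) ∧
      ‖e‖ ≤ C * s (k + N) * (‖normalMap (smoothPart f) lam (z (k + N)) (w (k + N))‖ + 1) := by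
    intro k
    obtain ⟨zi, wi, hz0, hw0, hstep, hz1, -⟩ := hw.epoch (k + N) (hN1 k)
    have hpos : 0 < α / (β + ((k + N : ℕ) : ℝ)) ^ γ := by
      have : (0 : ℝ) < ((k + N : ℕ) : ℝ) := by exact_mod_cast hN1 k
      positivity
    obtain ⟨e, he1, he2⟩ := exists_error_of_epoch hn hf hLip hproper hφ hlam hlamρ hpos
      (hG _ (mem_dom_of_mem_prox hproper (hprox _ (hN1 k))) (hR _ (hN1 k)))
      (by have := (hN (k + N) (hNk k)).2.2.2.2.1
          simp only [hs] at this
          linarith)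
      (π (k + N)) hz0 hw0 (hprox _ (hN1 k)) (fun i => (hstep i).1) (fun i => (hstep i).2)
    refine ⟨e, by rw [hz1, he1], he2.trans ?_⟩
    -- `G ≥ 1` allows `G` to be factored out into `C`.
    have h1 : ‖normalMap (smoothPart f) lam (z (k + N)) (w (k + N))‖ + G ≤
        G * (‖normalMap (smoothPart f) lam (z (k + N)) (w (k + N))‖ + 1) := by
      nlinarith [norm_nonneg (normalMap (smoothPart f) lam (z (k + N)) (w (k + N)))]
    refine (mul_le_mul_of_nonneg_left h1 (by positivity)).trans_eq ?_
    simp only [hC, hs]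
    ring
  choose e he1 he2 using herr
  obtain ⟨hsum, x, hx, hlim⟩ := summable_and_tendsto_of_inexact_steps (h := smoothPart f)
    (fun x => (hasGradientAt_smoothPart hf x).differentiableAt)
    (lipschitzOnWith_gradient_smoothPart hn hf hLip) hproper hφ hlsc hlam hlamρ
    (m := flb + φlb) (fun y hy => by
      have h1 := hφlb y hy
      rw [← hproper.coe_toReal hy] at h1
      exact add_le_add (le_smoothPart hn fun i => hflb i y hy) (by exact_mod_cast h1))
    (z := fun k => z (k + N)) (w := fun k => w (k + N)) (e := e) (a := fun k => s (k + N))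
    (A := n * α) (b := β + N) (γ := γ) (C := C) (M := M) (τ := τ) (R := R)
    (by positivity)
    (by have : (1 : ℝ) ≤ N := by exact_mod_cast (hN N le_rfl).1
        linarith) hγ hγ'
    (fun k => by
      have : β + ((k + N : ℕ) : ℝ) = β + N + k := by push_cast; ring
      simp only [hs]
      rw [this, Real.rpow_neg (by positivity)]
      ring)
    (by positivity) hM hτ0 (le_of_eq (by rw [hτ]; field_simp))
    (fun k => by simpa using (hN _ (hNk k)).2.1)
    (fun k => by rw [mul_comm]; exact (hN _ (hNk k)).2.2.1)
    (fun k => (hN _ (hNk k)).2.2.2.1)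
    (fun k => (hN _ (hNk k)).2.2.2.2.2)
    (fun k => hprox _ (hN1 k))
    (fun k => by simpa only [Nat.add_right_comm k 1 N] using he1 k)
    he2 (fun k => hR _ (hN1 k))
    (fun x hx hxd => by
      obtain ⟨l, hl, hlx⟩ := hx
      exact hKL x ⟨fun k => l k + N, fun i j hij => Nat.add_lt_add_right (hl hij) N, hlx⟩ hxd)
  refine ⟨?_, x, hx, (tendsto_add_atTop_iff_nat N).1 hlim⟩
  have h1 : Summable fun k => ‖w (k + 1) - w k‖ := by
    rw [← summable_nat_add_iff N]
    simpa only [Nat.add_right_comm _ 1 N] using hsum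
  exact (summable_nat_add_iff 1).2 h1
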